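/- There is an absolute constant $C>0$ such that the following holds. Let $d,n,k\ge1$ be integers, let $0<\delta,\epsilon<1$ and $\sqrt2\le\alpha\le2$, let $\mathcal X\subseteq\mathbb R^d$, and let $f:\mathbb R^d\to[0,\infty)$ be a probability density with respect to Lebesgue measure that vanishes outside $\mathcal X$. Let $X_n=(x_1,\dots,x_n)$ be an i.i.d. sample from $f$, and assume $$k\ \ge\ C\cdot\frac{d\log n}{\epsilon^2}\cdot\log^2\frac2\delta .$$ Write $B(x,\rho)$ for closed Euclidean balls, $v_d$ for the volume of the unit ball of $\mathbb R^d$, $Z_\sigma=\{y\in\mathbb R^d:\inf_{z\in Z}\|y-z\|\le\sigma\}$, $\Lambda=\sup_{x\in\mathcal X}f(x)\in[0,\infty]$, and $r_k(x_i)=\min\{\rho: B(x_i,\rho)\text{ contains at least }k\text{ data points}\}$ (with $r_k(x_i)=\infty$ if $k>n$). For $\rho\ge0$ let $G^{\rm NN}_\rho$ be the graph with nodes $\{x_i:r_k(x_i)\le \rho\}$ in which $x_i,x_j$ are adjacent iff $\|x_i-x_j\|\le\alpha\min(r_k(x_i),r_k(x_j))$ (mutual $k$-NN graph). The same theorem is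 asserted for the variant with $\max$ in place of $\min$ ($k$-NN graph). Then there is a mapping $r:[0,\infty)\to[0,\infty)$, with $\frac kn\le v_d\,r(\lambda)^d\lambda\le\frac kn\left(1+\frac\epsilon2\right)$ for all $\lambda>0$, such that with probability at least $1-\delta$ the following holds for all $\sigma>0$ and all path-connected (nonempty) sets $A,A'\subseteq\mathcal X$. Suppose that * any two points of $\mathcal X$ at distance at most $\sigma$ are joined by a straight segment inside $\mathcal X$ (which holds, for instance, if $\mathcal X$ is convex or $\mathcal X=\mathbb R^d$); * $A,A'$ are $(\sigma,\epsilon)$-separated, that is, there is $S\subseteq\mathcal X$ such that every path in $\mathcal X$ from $A$ to $A'$ meets $S$, and $\sup_{x\in S_\sigma}f(x)<(1-\epsilon)\lambda$, where $\lambda=\inf_{x\in A_\sigma\cup A'_\sigma}f(x)$ (a supremum over the empty set being $0$); * $n\ge\dfrac{k}{v_d(\sigma/2)^d\lambda}\left(1+\dfrac\epsilon2\right)$ and $k\ge\dfrac\Lambda\lambda\cdot C\,d\log n\cdot\log\dfrac2\delta$. Then: 1. (Separation) $A\cap X_n$ is disconnected from $A'\cap X_n$ in $G^{\rm NN}_{r(\lambda)}$: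 no node in $A$ lies in the same connected component as a node in $A'$. 2. (Connectedness) $A\cap X_n$ and $A'\cap X_n$ are each connected in $G^{\rm NN}_{r(\lambda)}$: all points of $A\cap X_n$ are nodes and lie in one connected component, and likewise for $A'$. -/

import Mathlib

open MeasureTheory
open scoped NNReal ENNReal

namespace ClusterTree

/-- Euclidean space `ℝ^d`. -/
abbrev E (d : ℕ) : Type := EuclideanSpace ℝ (Fin d)

/-- `v_d`, the Lebesgue volume of the unit ball of `ℝ^d`. -/
noncomputable def unitBallVolume (d : ℕ) : ℝ :=
  (volume (Metric.closedBall (0 : E d) 1)).toReal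

/-- `f` is a probability density (with respect to Lebesgue measure) supported on `X`;
it is a function on the whole space that vanishes outside `X`. -/
structure IsDensityOn {d : ℕ} (f : E d → ℝ≥0) (X : Set (E d)) : Prop where
  measurable : Measurable f
  lintegral_eq_one : ∫⁻ x, (f x : ℝ≥0∞) = 1
  eq_zero_of_notMem : ∀ x, x ∉ X → f x = 0

/-- The law of an i.i.d. sample `x_1, …, x_n` drawn from the density `f`. -/
noncomputable def sampleLaw {d : ℕ} (f : E d → ℝ≥0) (n : ℕ) : Measure (Fin n → E d) :=
  Measure.pi fun _ => volume.withDensity fun x => (f x : ℝ≥0∞)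

/-! ### Cluster salience

The closed `σ`-neighbourhood `Z_σ = {y | inf_{z ∈ Z} ‖y - z‖ ≤ σ}` is `Metric.cthickening σ Z`. -/

/-- `λ = inf {f x | x ∈ A_σ ∪ A'_σ}` (used for nonempty `A`, `A'` only). -/
noncomputable def level {d : ℕ} (f : E d → ℝ≥0) (σ : ℝ) (A A' : Set (E d)) : ℝ≥0 :=
  sInf (f '' (Metric.cthickening σ A ∪ Metric.cthickening σ A'))

/-- `A` and `A'` are `(σ, ε)`-separated for the density `f` on `X`: there is a separator `S ⊆ X`
which meets every path in `X` from `A` to `A'`, such that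
`sup_{S_σ} f < (1 - ε) inf_{A_σ ∪ A'_σ} f`. -/
def Separated {d : ℕ} (X : Set (E d)) (f : E d → ℝ≥0) (σ ε : ℝ) (A A' : Set (E d)) : Prop :=
  ∃ S : Set (E d), S ⊆ X ∧
    (∀ a ∈ A, ∀ a' ∈ A', ∀ γ : Path a a', (∀ t, γ t ∈ X) → ∃ t, γ t ∈ S) ∧
    (⨆ x ∈ Metric.cthickening σ S, (f x : ℝ≥0∞)) <
      ENNReal.ofReal (1 - ε) * (level f σ A A' : ℝ≥0∞)

/-- Any two points of `X` at distance at most `σ` are joined by a straight segment inside `X`.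
Every convex set, in particular the whole space, has this property for every `σ`. -/
def ConvexAtScale {d : ℕ} (X : Set (E d)) (σ : ℝ) : Prop :=
  ∀ x ∈ X, ∀ y ∈ X, dist x y ≤ σ → segment ℝ x y ⊆ X

/-! ### The `k`-nearest-neighbour cluster tree -/

/-- `r_k(x_i)`: the least `r` such that the closed ball `B(x_i, r)` contains `k` data points
(`x_i` included), and `∞` if there is no such `r`, that is, if `k > n`. -/
noncomputable def knnRadius {d n : ℕ} (x : Fin n → E d) (k : ℕ) (i : Fin n) : ℝ≥0∞ :=
  ⨅ (r : ℝ≥0) (_ : k ≤ Set.ncard {j : Fin n | x j ∈ Metric.closedBall (x i) (r : ℝ)}), (r : ℝ≥0∞)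

/-- The indices of the nodes `{x_i | r_k(x_i) ≤ r}` of `G^NN_r`. -/
def nodes {d n : ℕ} (x : Fin n → E d) (k : ℕ) (r : ℝ≥0) : Set (Fin n) :=
  {i | knnRadius x k i ≤ (r : ℝ≥0∞)}

/-- The two variants of the `k`-nearest-neighbour graph. -/
inductive Variant where
  | knn
  | mutual

/-- The scale of the edge rule: `max` for the `k`-NN graph, `min` for the mutual `k`-NN graph. -/
noncomputable def Variant.scale : Variant → ℝ≥0∞ → ℝ≥0∞ → ℝ≥0∞
  | .knn, a, b => max a b
  | .mutual, a, b => min a b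

/-- The graph `G^NN_r`: its nodes are the data points with `r_k(x_i) ≤ r`, and two nodes are
adjacent if `‖x_i - x_j‖ ≤ α max (r_k(x_i), r_k(x_j))` (`k`-NN graph), respectively
`‖x_i - x_j‖ ≤ α min (r_k(x_i), r_k(x_j))` (mutual `k`-NN graph). -/
noncomputable def nnGraph {d n : ℕ} (v : Variant) (α : ℝ) (k : ℕ) (x : Fin n → E d) (r : ℝ≥0) :
    SimpleGraph (nodes x k r) :=
  SimpleGraph.fromRel fun i j =>
    edist (x i.1) (x j.1) ≤
      ENNReal.ofReal α * v.scale (knnRadius x k i.1) (knnRadius x k j.1)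

/-- `A ∩ X_n` is disconnected from `A' ∩ X_n` in a graph `G` whose nodes are data points:
no node in `A` is in the same connected component as a node in `A'`. -/
def DisconnectedIn {d n : ℕ} {V : Set (Fin n)} (x : Fin n → E d) (G : SimpleGraph V)
    (A A' : Set (E d)) : Prop :=
  ∀ i j : V, x i.1 ∈ A → x j.1 ∈ A' → ¬ G.Reachable i j

/-- `A ∩ X_n` is connected in a graph `G` whose nodes are data points: all points of `A ∩ X_n`
are nodes of `G`, and they all lie in one connected component of `G`. -/
def ConnectedIn {d n : ℕ} {V : Set (Fin n)} (x : Fin n → E d) (G : SimpleGraph V)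
    (A : Set (E d)) : Prop :=
  ∀ i j : Fin n, x i ∈ A → x j ∈ A → ∃ (hi : i ∈ V) (hj : j ∈ V), G.Reachable ⟨i, hi⟩ ⟨j, hj⟩

end ClusterTree


/-!
Given one sample point, the masses of the balls around it through the other sample points are
independent and uniform on `[0, 1]`. Chernoff's bound for the number of those below `p` shows that
every ball around a sample point contains `k` sample points if its mass is at least
`k / n * (1 + ε / 2)`, and fewer than `k` if its mass is at most `k / n * (1 - ε / 2)`. So at the
radius `r` of the level `λ`, all sample points near `A` and `A'` are nodes, and no sample point
within distance `r` of the separator is. Edges have length at most `2 * r ≤ σ`, hence the segments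
along a walk in the graph from `A` to `A'` would form a path in `X` which avoids the separator.

For connectedness, let `r₀` be a lower bound for all nearest-neighbour radii, so that nodes at
distance at most `√2 * r₀` are adjacent. If `b` is within `r₀` of `a`, then the ball of radius
`√2 * r₀` around `b` covers half of the ball of radius `r₀` around `a`. A union bound over a finite
net shows that, up to small margins, all of these lenses contain sample points. A chain of sample
points can therefore follow a connected set.
-/

namespace ClusterTree

section Sampling

variable {Y : Type*}

/-- The number of sample points `x j` with `j ≠ i` to which `x i` is related by `R`. Given
`x i`, it is a binomial random variable. -/
noncomputable def relCount {n : ℕ} (R : Set (Y × Y)) (x : Fin n → Y) (i : Fin n) : ℕ :=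
  {j | j ≠ i ∧ (x i, x j) ∈ R}.ncard

lemma relCount_add_one_eq_ncard {n : ℕ} (R : Set (Y × Y)) (x : Fin n → Y) (i : Fin n) :
    relCount R x i + 1 = (insert i {j | j ≠ i ∧ (x i, x j) ∈ R}).ncard := by
  rw [Set.ncard_insert_of_notMem (by simp), relCount]

open Classical in
lemma prod_ite_mem_eq_pow_relCount {m : ℕ} (R : Set (Y × Y)) (x : Fin (m + 1) → Y)
    (i : Fin (m + 1)) (w : ℝ≥0∞) :
    ∏ j : Fin m, (if (x i, x (i.succAbove j)) ∈ R then w else 1) = w ^ relCount R x i := by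
  have hcount : relCount R x i = {j : Fin m | (x i, x (i.succAbove j)) ∈ R}.ncard := by
    rw [relCount, ← Set.ncard_image_of_injective _ (Fin.succAbove_right_injective (p := i))]
    congr 1
    ext j
    constructor
    · rintro ⟨hji, hj⟩
      obtain ⟨j, rfl⟩ := Fin.exists_succAbove_eq hji
      exact ⟨j, hj, rfl⟩
    · rintro ⟨j, hj, rfl⟩
      exact ⟨Fin.succAbove_ne i j, hj⟩
  simp [hcount, Finset.prod_ite, Set.ncard_eq_toFinset_card']

variable [MeasurableSpace Y]

lemma exists_measurableSet_forall_of_measure_not_le {μ : Measure Y} [IsProbabilityMeasure μ]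
    {P : Y → Prop} {δ : ℝ} (hδ : 0 ≤ δ) (h : μ {y | ¬ P y} ≤ ENNReal.ofReal δ) :
    ∃ Ω, MeasurableSet Ω ∧ ENNReal.ofReal (1 - δ) ≤ μ Ω ∧ ∀ y ∈ Ω, P y := by
  refine ⟨(toMeasurable μ {y | ¬ P y})ᶜ, (measurableSet_toMeasurable _ _).compl, ?_, fun y hy => ?_⟩
  · rw [prob_compl_eq_one_sub (measurableSet_toMeasurable _ _), measure_toMeasurable,
      ENNReal.ofReal_sub _ hδ, ENNReal.ofReal_one]
    exact tsub_le_tsub_left h 1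
  · exact not_not.1 fun hP => hy (subset_toMeasurable _ _ hP)

variable (μ : Measure Y) [IsProbabilityMeasure μ]

lemma measure_pi_forall_notMem_le (n : ℕ) {s : Set Y} (hs : MeasurableSet s) {p : ℝ}
    (h : p ≤ μ.real s) :
    Measure.pi (fun _ => μ) {x : Fin n → Y | ∀ j, x j ∉ s} ≤
      ENNReal.ofReal (Real.exp (-(n * p))) := by
  have hcompl : μ sᶜ ≤ ENNReal.ofReal (Real.exp (-p)) := by
    rw [← ofReal_measureReal, probReal_compl_eq_one_sub hs]
    exact ENNReal.ofReal_le_ofReal (by linarith [Real.add_one_le_exp (-p)])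
  have hpi : {x : Fin n → Y | ∀ j, x j ∉ s} = Set.univ.pi fun _ => sᶜ := by ext; simp
  calc Measure.pi (fun _ => μ) {x : Fin n → Y | ∀ j, x j ∉ s} = μ sᶜ ^ n := by
        simp [hpi, Measure.pi_pi]
    _ ≤ ENNReal.ofReal (Real.exp (-p)) ^ n := by gcongr
    _ = ENNReal.ofReal (Real.exp (-(n * p))) := by
        rw [← ENNReal.ofReal_pow (Real.exp_pos _).le, ← Real.exp_nat_mul, mul_neg]

lemma measure_pi_exists_forall_notMem_le {ι : Type*} (n : ℕ) (T : Finset ι) {s : ι → Set Y}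
    (hs : ∀ q, MeasurableSet (s q)) {p : ℝ} (h : ∀ q ∈ T, p ≤ μ.real (s q)) :
    Measure.pi (fun _ => μ) {x : Fin n → Y | ∃ q ∈ T, ∀ j, x j ∉ s q} ≤
      ENNReal.ofReal (T.card * Real.exp (-(n * p))) := by
  have hunion : {x : Fin n → Y | ∃ q ∈ T, ∀ j, x j ∉ s q} = ⋃ q ∈ T, {x | ∀ j, x j ∉ s q} := by
    ext; simp
  rw [hunion, ENNReal.ofReal_mul (by positivity), ENNReal.ofReal_natCast, ← nsmul_eq_mul]
  exact (measure_biUnion_finset_le _ _).trans (Finset.sum_le_card_nsmul _ _ _ fun q hq =>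
    measure_pi_forall_notMem_le μ n (hs q) (h q hq))

lemma lintegral_pi_prod_succAbove {m : ℕ} (i : Fin (m + 1)) {g : Y × Y → ℝ≥0∞}
    (hg : Measurable g) :
    ∫⁻ x : Fin (m + 1) → Y, ∏ j : Fin m, g (x i, x (i.succAbove j)) ∂Measure.pi (fun _ => μ) =
      ∫⁻ c, (∫⁻ z, g (c, z) ∂μ) ^ m ∂μ := by
  have hG : Measurable fun y : Y × (Fin m → Y) => ∏ j : Fin m, g (y.1, y.2 j) := by fun_prop
  have hsplit := (measurePreserving_piFinSuccAbove (fun _ : Fin (m + 1) => μ) i).lintegral_comp hG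
  rw [lintegral_prod _ hG.aemeasurable] at hsplit
  refine hsplit.trans (lintegral_congr fun c => ?_)
  have hc : Measurable fun z => g (c, z) := by fun_prop
  have hindep := ProbabilityTheory.iIndepFun_pi (μ := fun _ : Fin m => μ)
    (X := fun _ z => g (c, z)) (fun _ => hc.aemeasurable)
  have hfactor (j : Fin m) :
      ∫⁻ y : Fin m → Y, g (c, y j) ∂Measure.pi (fun _ => μ) = ∫⁻ z, g (c, z) ∂μ :=
    (measurePreserving_eval (fun _ : Fin m => μ) j).lintegral_comp hc
  simpa [hfactor] using ProbabilityTheory.lintegral_prod_eq_prod_lintegral_of_indepFun Finset.univ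
    (fun (j : Fin m) (y : Fin m → Y) => g (c, y j)) hindep
    fun j => hc.comp (measurable_pi_apply j)

lemma measurable_pow_relCount {m : ℕ} (i : Fin (m + 1)) {R : Set (Y × Y)} (hR : MeasurableSet R)
    (w : ℝ≥0∞) : Measurable fun x : Fin (m + 1) → Y => w ^ relCount R x i := by
  classical
  have hg : Measurable fun y : Y × Y => if y ∈ R then w else 1 :=
    Measurable.ite hR measurable_const measurable_const
  simp only [← prod_ite_mem_eq_pow_relCount]
  exact Finset.measurable_prod _ fun j _ =>
    hg.comp ((measurable_pi_apply i).prodMk (measurable_pi_apply (i.succAbove j)))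

lemma lintegral_pow_relCount {m : ℕ} (i : Fin (m + 1)) {R : Set (Y × Y)} (hR : MeasurableSet R)
    (w : ℝ≥0∞) :
    ∫⁻ x : Fin (m + 1) → Y, w ^ relCount R x i ∂Measure.pi (fun _ => μ) =
      ∫⁻ c, (w * μ {z | (c, z) ∈ R} + μ {z | (c, z) ∉ R}) ^ m ∂μ := by
  classical
  have hg : Measurable fun y : Y × Y => if y ∈ R then w else 1 :=
    Measurable.ite hR measurable_const measurable_const
  simp only [← prod_ite_mem_eq_pow_relCount]
  rw [lintegral_pi_prod_succAbove μ i hg]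
  refine lintegral_congr fun c => ?_
  have hRc : MeasurableSet {z | (c, z) ∈ R} := measurable_prodMk_left hR
  rw [← lintegral_add_compl _ hRc, setLIntegral_congr_fun hRc fun z (hz : (c, z) ∈ R) => if_pos hz,
    setLIntegral_congr_fun hRc.compl fun z (hz : (c, z) ∉ R) => if_neg hz, setLIntegral_const,
    setLIntegral_const, one_mul]
  rfl

/-- Chernoff's bound; the sign of `t` decides which tail is estimated. -/
lemma measure_mul_le_mul_relCount_le {n : ℕ} (i : Fin n) {R : Set (Y × Y)}
    (hR : MeasurableSet R) {t q : ℝ} (h : ∀ c, (Real.exp t - 1) * μ.real {z | (c, z) ∈ R} ≤ q)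
    (a : ℝ) :
    Measure.pi (fun _ => μ) {x : Fin n → Y | t * a ≤ t * relCount R x i} ≤
      ENNReal.ofReal (Real.exp ((n - 1) * q - t * a)) := by
  obtain ⟨m, rfl⟩ := Nat.exists_eq_add_one.2 i.pos
  have hbase (c : Y) : ENNReal.ofReal (Real.exp t) * μ {z | (c, z) ∈ R} + μ {z | (c, z) ∉ R} ≤
      ENNReal.ofReal (Real.exp q) := by
    have hcompl : μ.real {z | (c, z) ∉ R} = 1 - μ.real {z | (c, z) ∈ R} :=
      probReal_compl_eq_one_sub (measurable_prodMk_left hR)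
    rw [← ofReal_measureReal, ← ofReal_measureReal, hcompl, ← ENNReal.ofReal_mul (by positivity),
      ← ENNReal.ofReal_add (by positivity) (hcompl ▸ measureReal_nonneg)]
    exact ENNReal.ofReal_le_ofReal (by linarith [h c, Real.add_one_le_exp q])
  have hpgf : ∫⁻ x : Fin (m + 1) → Y, ENNReal.ofReal (Real.exp t) ^ relCount R x i
      ∂Measure.pi (fun _ => μ) ≤ ENNReal.ofReal (Real.exp (m * q)) := by
    rw [lintegral_pow_relCount μ i hR, Real.exp_nat_mul, ENNReal.ofReal_pow (Real.exp_pos q).le]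
    calc _ ≤ ∫⁻ _, ENNReal.ofReal (Real.exp q) ^ m ∂μ :=
          lintegral_mono fun c => pow_le_pow_left' (hbase c) m
      _ = _ := by simp
  have hmarkov := meas_ge_le_lintegral_div (μ := Measure.pi fun _ : Fin (m + 1) => μ)
    (measurable_pow_relCount i hR (ENNReal.ofReal (Real.exp t))).aemeasurable
    (ε := ENNReal.ofReal (Real.exp (t * a))) (by simp [Real.exp_pos]) ENNReal.ofReal_ne_top
  calc Measure.pi (fun _ => μ) {x : Fin (m + 1) → Y | t * a ≤ t * relCount R x i}
      ≤ Measure.pi (fun _ => μ) {x : Fin (m + 1) → Y | ENNReal.ofReal (Real.exp (t * a)) ≤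
          ENNReal.ofReal (Real.exp t) ^ relCount R x i} := by
        refine measure_mono fun x hx => ?_
        rw [Set.mem_ofPred_eq, ← ENNReal.ofReal_pow (Real.exp_pos t).le, ← Real.exp_nat_mul,
          mul_comm _ t]
        exact ENNReal.ofReal_le_ofReal (Real.exp_le_exp.2 hx)
    _ ≤ ENNReal.ofReal (Real.exp (m * q)) / ENNReal.ofReal (Real.exp (t * a)) :=
        hmarkov.trans (ENNReal.div_le_div_right hpgf _)
    _ = ENNReal.ofReal (Real.exp (((m + 1 : ℕ) - 1) * q - t * a)) := by
        rw [← ENNReal.ofReal_div_of_pos (Real.exp_pos _), ← Real.exp_sub]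
        push_cast
        rw [add_sub_cancel_right]

/-- The summand `1` absorbs the passage from the `n - 1` sample points other than `x i` to `n`. -/
lemma measure_mul_sub_one_le_mul_relCount_le {n : ℕ} (i : Fin n) {R : Set (Y × Y)}
    (hR : MeasurableSet R) {t p : ℝ} (ht : t ≤ 1) (hp₀ : 0 ≤ p) (hp₁ : p ≤ 1)
    (h : ∀ c, (Real.exp t - 1) * μ.real {z | (c, z) ∈ R} ≤ (Real.exp t - 1) * p) (k : ℝ) :
    Measure.pi (fun _ => μ) {x : Fin n → Y | t * (k - 1) ≤ t * relCount R x i} ≤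
      ENNReal.ofReal (Real.exp (1 + n * p * (Real.exp t - 1) - t * k)) := by
  refine (measure_mul_le_mul_relCount_le μ i hR h (k - 1)).trans (ENNReal.ofReal_le_ofReal ?_)
  have hexp := Real.add_one_le_exp t
  exact Real.exp_le_exp.2 (by nlinarith)

end Sampling

section Concentration

variable {Y : Type*} [PseudoMetricSpace Y] [MeasurableSpace Y]

/-- The mass of the closed ball around `y.1` which has `y.2` on its boundary. It ranks the points
`y.2` by their distance to `y.1`. -/
noncomputable def ballMass (μ : Measure Y) (y : Y × Y) : ℝ :=
  μ.real (Metric.closedBall y.1 (dist y.2 y.1))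

lemma relCount_add_one_le_ncard (μ : Measure Y) [IsFiniteMeasure μ] {n : ℕ} (x : Fin n → Y)
    (i : Fin n) {ρ p : ℝ} (hρ : 0 ≤ ρ) (hp : p < μ.real (Metric.closedBall (x i) ρ)) :
    relCount {y | ballMass μ y ≤ p} x i + 1 ≤ {j | x j ∈ Metric.closedBall (x i) ρ}.ncard := by
  rw [relCount_add_one_eq_ncard]
  refine Set.ncard_le_ncard (Set.insert_subset (by simpa using hρ) fun j hj => ?_)
  by_contra hfar
  have hle : ρ ≤ dist (x j) (x i) := (not_le.1 hfar).le
  exact (hj.2 : ballMass μ _ ≤ p).not_gt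
    (hp.trans_le (measureReal_mono (Metric.closedBall_subset_closedBall hle)))

lemma ncard_le_relCount_add_one (μ : Measure Y) [IsFiniteMeasure μ] {n : ℕ} (x : Fin n → Y)
    (i : Fin n) {ρ p : ℝ} (hp : μ.real (Metric.closedBall (x i) ρ) < p) :
    {j | x j ∈ Metric.closedBall (x i) ρ}.ncard ≤ relCount {y | ballMass μ y < p} x i + 1 := by
  rw [relCount_add_one_eq_ncard]
  refine Set.ncard_le_ncard fun j hj => or_iff_not_imp_left.2 fun hji => ⟨hji, ?_⟩
  exact (measureReal_mono (Metric.closedBall_subset_closedBall hj)).trans_lt hp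

/-- The balls around the sample points with at least, respectively at most, `1 ± ε / 2` times the
mass `k / n` contain at least, respectively fewer than, `k` sample points. This brackets the
`k`-nearest-neighbour radii. -/
structure ConcentratedCounts (μ : Measure Y) {n : ℕ} (k : ℕ) (ε : ℝ) (x : Fin n → Y) : Prop where
  le_ncard : ∀ i ρ, k / n * (1 + ε / 2) ≤ μ.real (Metric.closedBall (x i) ρ) →
    k ≤ {j | x j ∈ Metric.closedBall (x i) ρ}.ncard
  ncard_lt : ∀ i ρ, μ.real (Metric.closedBall (x i) ρ) ≤ k / n * (1 - ε / 2) →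
    {j | x j ∈ Metric.closedBall (x i) ρ}.ncard < k

lemma concentratedCounts_of_relCount {μ : Measure Y} [IsFiniteMeasure μ] {n k : ℕ} (hk : 0 < k)
    {ε : ℝ} (hε₀ : 0 < ε) {x : Fin n → Y}
    (hlow : ∀ i, k ≤ relCount {y | ballMass μ y ≤ k / n * (1 + ε / 3)} x i + 1)
    (hup : ∀ i, relCount {y | ballMass μ y < k / n * (1 - ε / 3)} x i + 1 < k) :
    ConcentratedCounts μ k ε x where
  le_ncard i ρ hρ := by
    have hn : (0 : ℝ) < n := by exact_mod_cast i.pos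
    have hlt : k / n * (1 + ε / 3) < μ.real (Metric.closedBall (x i) ρ) :=
      (mul_lt_mul_of_pos_left (by linarith) (by positivity)).trans_le hρ
    have hρ₀ : 0 ≤ ρ := by
      by_contra! hneg
      rw [Metric.closedBall_eq_empty.2 hneg, measureReal_empty] at hlt
      exact hlt.not_ge (by positivity)
    exact (hlow i).trans (relCount_add_one_le_ncard μ x i hρ₀ hlt)
  ncard_lt i ρ hρ := by
    have hn : (0 : ℝ) < n := by exact_mod_cast i.pos
    have hlt : μ.real (Metric.closedBall (x i) ρ) < k / n * (1 - ε / 3) :=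
      hρ.trans_lt (mul_lt_mul_of_pos_left (by linarith) (by positivity))
    exact (ncard_le_relCount_add_one μ x i hlt).trans_lt (hup i)

variable [OpensMeasurableSpace Y]

lemma continuous_measureReal_closedBall (μ : Measure Y) [IsFiniteMeasure μ] {c : Y}
    (hc : ∀ r, μ (Metric.sphere c r) = 0) :
    Continuous fun ρ : ℝ => μ.real (Metric.closedBall c ρ) := by
  refine continuous_iff_continuousAt.2 fun ρ =>
    (ENNReal.tendsto_toReal (measure_ne_top _ _)).comp
      (tendsto_measure_of_ae_tendsto_indicator_of_isFiniteMeasure _ measurableSet_closedBall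
        (fun _ => measurableSet_closedBall) ?_)
  filter_upwards [compl_mem_ae_iff.2 (hc ρ)] with z hz
  rcases lt_or_gt_of_ne (show dist z c ≠ ρ from hz) with h | h
  · filter_upwards [lt_mem_nhds h] with ρ' h'
    simp [h.le, h'.le]
  · filter_upwards [gt_mem_nhds h] with ρ' h'
    simp [h.not_ge, h'.not_ge]

lemma exists_measureReal_closedBall_eq (μ : Measure Y) [IsFiniteMeasure μ] {c : Y}
    (hc : ∀ r, μ (Metric.sphere c r) = 0) {p : ℝ} (hp₀ : 0 ≤ p) (hp₁ : p < μ.real Set.univ) :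
    ∃ ρ : ℝ, μ.real (Metric.closedBall c ρ) = p := by
  have hlim : Filter.Tendsto (fun m : ℕ => μ.real (Metric.closedBall c m)) Filter.atTop
      (nhds (μ.real Set.univ)) := by
    rw [← Metric.iUnion_closedBall_nat c]
    exact (ENNReal.tendsto_toReal (measure_ne_top _ _)).comp (tendsto_measure_iUnion_atTop
      fun a b hab => Metric.closedBall_subset_closedBall (by exact_mod_cast hab))
  obtain ⟨m, hm⟩ := (hlim.eventually (lt_mem_nhds hp₁)).exists
  exact mem_range_of_exists_le_of_exists_ge (continuous_measureReal_closedBall μ hc)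
    ⟨-1, by simpa using hp₀⟩ ⟨m, hm.le⟩

lemma le_measureReal_ballMass_le (μ : Measure Y) [IsFiniteMeasure μ] {c : Y}
    (hc : ∀ r, μ (Metric.sphere c r) = 0) {p : ℝ} (hp₀ : 0 ≤ p) (hp₁ : p < μ.real Set.univ) :
    p ≤ μ.real {z | ballMass μ (c, z) ≤ p} := by
  obtain ⟨ρ, rfl⟩ := exists_measureReal_closedBall_eq μ hc hp₀ hp₁
  exact measureReal_mono fun z hz => measureReal_mono (Metric.closedBall_subset_closedBall hz)

lemma measureReal_ballMass_lt_le (μ : Measure Y) [IsFiniteMeasure μ] {c : Y}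
    (hc : ∀ r, μ (Metric.sphere c r) = 0) {p : ℝ} (hp₀ : 0 ≤ p) (hp₁ : p < μ.real Set.univ) :
    μ.real {z | ballMass μ (c, z) < p} ≤ p := by
  obtain ⟨ρ, rfl⟩ := exists_measureReal_closedBall_eq μ hc hp₀ hp₁
  refine measureReal_mono fun z hz => ?_
  by_contra hfar
  exact (show ballMass μ (c, z) < _ from hz).not_ge
    (measureReal_mono (Metric.closedBall_subset_closedBall (not_le.1 hfar).le))

lemma measurable_ballMass [SecondCountableTopology Y] (μ : Measure Y) [SFinite μ] :
    Measurable (ballMass μ) := by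
  have hs : MeasurableSet {q : (Y × Y) × Y | dist q.2 q.1.1 ≤ dist q.1.2 q.1.1} :=
    (isClosed_le (by fun_prop) (by fun_prop)).measurableSet
  exact (measurable_measure_prodMk_left hs).ennreal_toReal

lemma chernoff_exponent_lower {ε : ℝ} (hε₀ : 0 ≤ ε) (hε₁ : ε ≤ 1) :
    (1 + ε / 3) * (Real.exp (-(ε / 8)) - 1) + ε / 8 ≤ -(ε ^ 2 / 48) := by
  have hexp : Real.exp (-(ε / 8)) - 1 ≤ -(ε / 8) + (ε / 8) ^ 2 := by
    have h := (abs_le.1 (Real.abs_exp_sub_one_sub_id_le (x := -(ε / 8))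
      (by rw [abs_neg, abs_of_nonneg (by positivity)]; linarith))).2
    rw [neg_sq] at h
    linarith
  calc (1 + ε / 3) * (Real.exp (-(ε / 8)) - 1) + ε / 8
      ≤ (1 + ε / 3) * (-(ε / 8) + (ε / 8) ^ 2) + ε / 8 := by gcongr
    _ = -(ε ^ 2 / 48) - ε ^ 2 / 192 * (1 - ε) := by ring
    _ ≤ -(ε ^ 2 / 48) := by nlinarith [sq_nonneg ε]

lemma chernoff_exponent_upper {ε : ℝ} (hε₀ : 0 ≤ ε) (hε₁ : ε ≤ 1) :
    (1 - ε / 3) * (Real.exp (ε / 6) - 1) - ε / 6 ≤ -(ε ^ 2 / 48) := by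
  have hexp : Real.exp (ε / 6) - 1 ≤ ε / 6 + (ε / 6) ^ 2 := by
    have h := (abs_le.1 (Real.abs_exp_sub_one_sub_id_le (x := ε / 6)
      (by rw [abs_of_nonneg (by positivity)]; linarith))).2
    linarith
  have hfac : 0 ≤ 1 - ε / 3 := by linarith
  calc (1 - ε / 3) * (Real.exp (ε / 6) - 1) - ε / 6
      ≤ (1 - ε / 3) * (ε / 6 + (ε / 6) ^ 2) - ε / 6 := by gcongr
    _ = -(ε ^ 2 / 36) - ε ^ 3 / 108 := by ring
    _ ≤ -(ε ^ 2 / 48) := by nlinarith [sq_nonneg ε, pow_nonneg hε₀ 3]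

variable [SecondCountableTopology Y] {μ : Measure Y} [IsProbabilityMeasure μ]

lemma measure_relCount_add_one_lt_le (hμ : ∀ c r, μ (Metric.sphere c r) = 0) {n k : ℕ} {ε : ℝ}
    (hε₀ : 0 ≤ ε) (hε₁ : ε ≤ 1) (hkn : k / n * (1 + ε / 3) < 1) (i : Fin n) :
    Measure.pi (fun _ => μ)
        {x : Fin n → Y | relCount {y | ballMass μ y ≤ k / n * (1 + ε / 3)} x i + 1 < k} ≤
      ENNReal.ofReal (Real.exp (1 - k * ε ^ 2 / 48)) := by
  have hn : (0 : ℝ) < n := by exact_mod_cast i.pos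
  have hR : MeasurableSet {y | ballMass μ y ≤ k / n * (1 + ε / 3)} :=
    measurableSet_le (measurable_ballMass μ) measurable_const
  have hmass (c : Y) := mul_le_mul_of_nonpos_left
    (le_measureReal_ballMass_le μ (hμ c) (p := k / n * (1 + ε / 3)) (by positivity)
      (by simpa only [probReal_univ] using hkn))
    (show Real.exp (-(ε / 8)) - 1 ≤ 0 by simpa using by positivity)
  refine (measure_mono fun x hx => ?_).trans
    ((measure_mul_sub_one_le_mul_relCount_le μ i hR (t := -(ε / 8)) (by linarith)
      (by positivity) hkn.le hmass k).trans (ENNReal.ofReal_le_ofReal (Real.exp_le_exp.2 ?_)))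
  · have hlt : (relCount {y | ballMass μ y ≤ k / n * (1 + ε / 3)} x i : ℝ) + 1 ≤ k := by
      exact_mod_cast (show _ + 1 < k from hx).le
    rw [Set.mem_ofPred_eq]
    exact mul_le_mul_of_nonpos_left (by linarith) (by linarith)
  · have hexponent := mul_le_mul_of_nonneg_left (chernoff_exponent_lower hε₀ hε₁) k.cast_nonneg
    rw [← mul_assoc (n : ℝ), mul_div_cancel₀ _ hn.ne']
    linarith

lemma measure_le_relCount_add_one_le (hμ : ∀ c r, μ (Metric.sphere c r) = 0) {n k : ℕ} {ε : ℝ}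
    (hε₀ : 0 ≤ ε) (hε₁ : ε ≤ 1) (hkn : k / n * (1 - ε / 3) < 1) (i : Fin n) :
    Measure.pi (fun _ => μ)
        {x : Fin n → Y | k ≤ relCount {y | ballMass μ y < k / n * (1 - ε / 3)} x i + 1} ≤
      ENNReal.ofReal (Real.exp (1 - k * ε ^ 2 / 48)) := by
  have hn : (0 : ℝ) < n := by exact_mod_cast i.pos
  have hp : 0 ≤ k / n * (1 - ε / 3) := mul_nonneg (by positivity) (by linarith)
  have hR : MeasurableSet {y | ballMass μ y < k / n * (1 - ε / 3)} :=
    measurableSet_lt (measurable_ballMass μ) measurable_const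
  have hmass (c : Y) := mul_le_mul_of_nonneg_left
    (measureReal_ballMass_lt_le μ (hμ c) hp (by simpa only [probReal_univ] using hkn))
    (show 0 ≤ Real.exp (ε / 6) - 1 by simpa using by positivity)
  refine (measure_mono fun x hx => ?_).trans
    ((measure_mul_sub_one_le_mul_relCount_le μ i hR (t := ε / 6) (by linarith) hp hkn.le
      hmass k).trans (ENNReal.ofReal_le_ofReal (Real.exp_le_exp.2 ?_)))
  · have hle : (k : ℝ) ≤ relCount {y | ballMass μ y < k / n * (1 - ε / 3)} x i + 1 := by
      exact_mod_cast (show k ≤ _ + 1 from hx)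
    rw [Set.mem_ofPred_eq]
    exact mul_le_mul_of_nonneg_left (by linarith) (by positivity)
  · have hexponent := mul_le_mul_of_nonneg_left (chernoff_exponent_upper hε₀ hε₁) k.cast_nonneg
    rw [← mul_assoc (n : ℝ), mul_div_cancel₀ _ hn.ne']
    linarith

lemma measure_not_concentratedCounts_le (hμ : ∀ c r, μ (Metric.sphere c r) = 0) {n k : ℕ}
    (hk : 0 < k) {ε : ℝ} (hε₀ : 0 < ε) (hε₁ : ε < 1) (hkn : k * (1 + ε / 2) ≤ n) :
    Measure.pi (fun _ => μ) {x : Fin n → Y | ¬ ConcentratedCounts μ k ε x} ≤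
      ENNReal.ofReal (2 * n * Real.exp (1 - k * ε ^ 2 / 48)) := by
  have hk' : (0 : ℝ) < k := by exact_mod_cast hk
  have hn : (0 : ℝ) < n := lt_of_lt_of_le (by positivity) hkn
  have hlow : k / n * (1 + ε / 3) < 1 := by
    rw [div_mul_eq_mul_div, div_lt_one hn]
    nlinarith
  have hup : k / n * (1 - ε / 3) < 1 := by
    rw [div_mul_eq_mul_div, div_lt_one hn]
    nlinarith
  calc Measure.pi (fun _ => μ) {x : Fin n → Y | ¬ ConcentratedCounts μ k ε x}
      ≤ Measure.pi (fun _ => μ) (⋃ i : Fin n,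
          {x | relCount {y | ballMass μ y ≤ k / n * (1 + ε / 3)} x i + 1 < k} ∪
          {x | k ≤ relCount {y | ballMass μ y < k / n * (1 - ε / 3)} x i + 1}) := by
        refine measure_mono fun x hx => ?_
        by_contra hno
        simp only [Set.mem_iUnion, Set.mem_union, Set.mem_ofPred_eq, not_exists, not_or, not_lt,
          not_le] at hno
        exact hx (concentratedCounts_of_relCount hk hε₀ (fun i => (hno i).1) fun i => (hno i).2)
    _ ≤ ∑ _i : Fin n, (ENNReal.ofReal (Real.exp (1 - k * ε ^ 2 / 48)) +
          ENNReal.ofReal (Real.exp (1 - k * ε ^ 2 / 48))) :=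
        (measure_iUnion_fintype_le _ _).trans (Finset.sum_le_sum fun i _ =>
          (measure_union_le _ _).trans (add_le_add
            (measure_relCount_add_one_lt_le hμ hε₀.le hε₁.le hlow i)
            (measure_le_relCount_add_one_le hμ hε₀.le hε₁.le hup i)))
    _ = ENNReal.ofReal (2 * n * Real.exp (1 - k * ε ^ 2 / 48)) := by
        rw [Finset.sum_const, Finset.card_univ, Fintype.card_fin, ← two_mul, nsmul_eq_mul,
          ← mul_assoc, mul_comm (n : ℝ≥0∞), ENNReal.ofReal_mul (by positivity),
          ENNReal.ofReal_mul two_pos.le]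
        simp

end Concentration

section Packing

variable {Y : Type*} [PseudoMetricSpace Y] [MeasurableSpace Y] [OpensMeasurableSpace Y]

lemma encard_mul_le_measure_univ (μ : Measure Y) {h : ℝ≥0} {C : Set Y}
    (hC : Metric.IsSeparated h C) {m : ℝ≥0∞}
    (hm : ∀ c ∈ C, m ≤ μ (Metric.closedBall c (h / 2))) :
    (C.encard : ℝ≥0∞) * m ≤ μ Set.univ := by
  have hdisj : Pairwise (Function.onFun Disjoint fun c : C => Metric.closedBall c.1 (h / 2)) := by
    intro a b hab
    have hsep : h < edist a.1 b.1 := hC a.2 b.2 (Subtype.coe_ne_coe.2 hab)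
    rw [edist_nndist, ENNReal.coe_lt_coe, ← NNReal.coe_lt_coe, coe_nndist] at hsep
    exact Metric.closedBall_disjoint_closedBall (by rwa [add_halves])
  calc (C.encard : ℝ≥0∞) * m = ∑' _ : C, m := (ENNReal.tsum_const m).symm
    _ ≤ ∑' c : C, μ (Metric.closedBall c.1 (h / 2)) := ENNReal.tsum_le_tsum fun c => hm c c.2
    _ ≤ μ (⋃ c : C, Metric.closedBall c.1 (h / 2)) :=
        tsum_meas_le_meas_iUnion_of_disjoint μ (fun _ => measurableSet_closedBall) hdisj
    _ ≤ μ Set.univ := measure_mono (Set.subset_univ _)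

lemma packingNumber_mul_le_measure_univ (μ : Measure Y) {h : ℝ≥0} {D : Set Y} {m : ℝ≥0∞}
    (hm : ∀ c ∈ D, m ≤ μ (Metric.closedBall c (h / 2))) :
    (Metric.packingNumber h D : ℝ≥0∞) * m ≤ μ Set.univ := by
  simp only [Metric.packingNumber, ENat.toENNReal_iSup, ENNReal.iSup_mul, iSup_le_iff]
  exact fun C hCD hC => encard_mul_le_measure_univ μ hC fun c hc => hm c (hCD hc)

lemma exists_finset_forall_dist_le (μ : Measure Y) [IsFiniteMeasure μ] {h m : ℝ} (hh : 0 ≤ h)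
    (hm₀ : 0 < m) {D : Set Y} (hm : ∀ c ∈ D, m ≤ μ.real (Metric.closedBall c (h / 2))) :
    ∃ N : Finset Y, N.card * m ≤ μ.real Set.univ ∧ ∀ c ∈ D, ∃ p ∈ N, dist c p ≤ h := by
  lift h to ℝ≥0 using hh
  have hpack : (Metric.packingNumber h D : ℝ≥0∞) * ENNReal.ofReal m ≤ μ Set.univ :=
    packingNumber_mul_le_measure_univ μ fun c hc =>
      (ENNReal.ofReal_le_iff_le_toReal (measure_ne_top _ _)).2 (hm c hc)
  have hfin : Metric.packingNumber h D ≠ ⊤ := by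
    intro htop
    rw [htop, ENat.toENNReal_top, ENNReal.top_mul (by simpa using hm₀)] at hpack
    exact measure_ne_top μ _ (top_le_iff.1 hpack)
  have hcard := Metric.encard_maximalSeparatedSet hfin
  have hcover := Metric.isCover_iff_subset_iUnion_closedBall.1
    (Metric.isCover_maximalSeparatedSet hfin)
  have hN : (Metric.maximalSeparatedSet h D).Finite := Set.encard_ne_top_iff.1 (hcard ▸ hfin)
  refine ⟨hN.toFinset, ?_, fun c hc => by simpa using hcover hc⟩
  rw [← hcard, hN.encard_eq_coe_toFinset_card] at hpack
  simpa [measureReal_def, ENNReal.toReal_ofReal hm₀.le] using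
    ENNReal.toReal_mono (measure_ne_top μ _) hpack

end Packing

section Lens

variable {F : Type*} [NormedAddCommGroup F] [InnerProductSpace ℝ F] [MeasurableSpace F]
  [BorelSpace F]

/-- The point reflection of the ball in its centre `a` maps the part outside the lens into the
lens, by the parallelogram law. -/
lemma measure_closedBall_le_two_mul_measure_inter (μ : Measure F) [μ.IsAddLeftInvariant]
    [μ.IsNegInvariant] {a b : F} {R T : ℝ} (hT : 0 ≤ T) (h : R ^ 2 + dist a b ^ 2 ≤ T ^ 2) :
    μ (Metric.closedBall a R) ≤ 2 * μ (Metric.closedBall a R ∩ Metric.closedBall b T) := by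
  set S := Metric.closedBall a R ∩ Metric.closedBall b T
  have hreflect : μ ((fun z => a + a - z) ⁻¹' S) = μ S :=
    (Measure.measurePreserving_sub_left μ (a + a)).measure_preimage
      (measurableSet_closedBall.inter measurableSet_closedBall).nullMeasurableSet
  have hcover : Metric.closedBall a R ⊆ S ∪ (fun z => a + a - z) ⁻¹' S := by
    intro z hz
    have hza : dist z a ≤ R := hz
    have hpar := parallelogram_law_with_norm ℝ (a - b) (z - a)
    rw [show a - b + (z - a) = z - b by abel, show a - b - (z - a) = a + a - z - b by abel,
      ← dist_eq_norm, ← dist_eq_norm, ← dist_eq_norm, ← dist_eq_norm] at hpar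
    have hsq : dist z a ^ 2 ≤ R ^ 2 := by gcongr
    rcases le_total (dist z b) (dist (a + a - z) b) with hle | hle
    · have hsq' : dist z b ^ 2 ≤ dist (a + a - z) b ^ 2 := by gcongr
      exact Or.inl ⟨hz, abs_le_of_sq_le_sq' (by linarith) hT |>.2⟩
    · have hsq' : dist (a + a - z) b ^ 2 ≤ dist z b ^ 2 := by gcongr
      refine Or.inr ⟨?_, abs_le_of_sq_le_sq' (by linarith) hT |>.2⟩
      rwa [Metric.mem_closedBall, dist_eq_norm, show a + a - z - a = a - z by abel,
        ← dist_eq_norm, dist_comm]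
  calc μ (Metric.closedBall a R) ≤ μ S + μ ((fun z => a + a - z) ⁻¹' S) :=
        (measure_mono hcover).trans (measure_union_le _ _)
    _ = 2 * μ S := by rw [hreflect, two_mul]

end Lens

section Density

variable {α : Type*} [MeasurableSpace α] {μ : Measure α} {g : α → ℝ≥0∞} {s : Set α} {c : ℝ≥0∞}

lemma mul_measure_le_withDensity (hs : MeasurableSet s) (h : ∀ z ∈ s, c ≤ g z) :
    c * μ s ≤ μ.withDensity g s := by
  rw [withDensity_apply _ hs, ← setLIntegral_const]
  exact setLIntegral_mono' hs h

lemma withDensity_le_mul_measure (hs : MeasurableSet s) (h : ∀ z ∈ s, g z ≤ c) :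
    μ.withDensity g s ≤ c * μ s := by
  rw [withDensity_apply _ hs, ← setLIntegral_const]
  exact setLIntegral_mono' hs h

variable {d n : ℕ} {f : E d → ℝ≥0} {X : Set (E d)} {R : ℝ}

lemma unitBallVolume_pos : 0 < unitBallVolume d :=
  ENNReal.toReal_pos (Metric.measure_closedBall_pos _ _ one_pos).ne' measure_closedBall_lt_top.ne

lemma volume_closedBall_eq (a : E d) (hR : 0 ≤ R) :
    volume (Metric.closedBall a R) = ENNReal.ofReal (unitBallVolume d * R ^ d) := by
  rw [Measure.addHaar_closedBall' _ _ hR, mul_comm, ENNReal.ofReal_mul unitBallVolume_pos.le,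
    unitBallVolume, ENNReal.ofReal_toReal measure_closedBall_lt_top.ne]
  simp

/-- The radius of the balls of volume `a` in `ℝ^d`. -/
noncomputable def volumeRadius (d : ℕ) (a : ℝ) : ℝ≥0 :=
  ((a / unitBallVolume d) ^ (1 / d : ℝ)).toNNReal

lemma unitBallVolume_mul_volumeRadius_pow (hd : 0 < d) {a : ℝ} (ha : 0 ≤ a) :
    unitBallVolume d * (volumeRadius d a : ℝ) ^ d = a := by
  have hV := unitBallVolume_pos (d := d)
  rw [volumeRadius, Real.coe_toNNReal _ (by positivity), one_div,
    Real.rpow_inv_natCast_pow (by positivity) hd.ne', mul_div_cancel₀ _ hV.ne']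

lemma volumeRadius_le (hd : 0 < d) {a : ℝ} (ha : 0 ≤ a) (hR : 0 ≤ R)
    (h : a ≤ unitBallVolume d * R ^ d) : (volumeRadius d a : ℝ) ≤ R := by
  rw [← unitBallVolume_mul_volumeRadius_pow hd ha] at h
  exact le_of_pow_le_pow_left₀ hd.ne' hR (le_of_mul_le_mul_left h unitBallVolume_pos)

/-- The law of one sample point. -/
noncomputable abbrev law (f : E d → ℝ≥0) : Measure (E d) :=
  volume.withDensity fun x => (f x : ℝ≥0∞)

lemma IsDensityOn.isProbabilityMeasure (hf : IsDensityOn f X) : IsProbabilityMeasure (law f) :=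
  ⟨by simpa [law] using hf.lintegral_eq_one⟩

lemma IsDensityOn.ae_forall_mem (hf : IsDensityOn f X) (n : ℕ) :
    ∀ᵐ x ∂sampleLaw f n, ∀ i, x i ∈ X := by
  have := hf.isProbabilityMeasure
  have hmem : ∀ᵐ z ∂law f, z ∈ X :=
    (ae_withDensity_iff hf.measurable.coe_nnreal_ennreal).2 <| .of_forall fun z hz => by
      by_contra hzX
      exact hz (by simpa using hf.eq_zero_of_notMem z hzX)
  exact ae_all_iff.2 fun i => (Measure.quasiMeasurePreserving_eval _ i).ae hmem

lemma law_sphere_eq_zero (hd : 0 < d) (f : E d → ℝ≥0) (a : E d) (r : ℝ) :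
    law f (Metric.sphere a r) = 0 := by
  have : Nonempty (Fin d) := ⟨⟨0, hd⟩⟩
  exact withDensity_absolutelyContinuous _ _ (Measure.addHaar_sphere _ _ _)

lemma mul_le_measureReal_law_closedBall [IsFiniteMeasure (law f)] {a : E d} {l : ℝ≥0} (hR : 0 ≤ R)
    (h : ∀ z ∈ Metric.closedBall a R, l ≤ f z) :
    l * (unitBallVolume d * R ^ d) ≤ (law f).real (Metric.closedBall a R) := by
  have hmass := mul_measure_le_withDensity (μ := volume) (g := fun z => (f z : ℝ≥0∞)) (c := l)
    measurableSet_closedBall fun z hz => ENNReal.coe_le_coe.2 (h z hz)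
  rw [volume_closedBall_eq a hR] at hmass
  have hV := unitBallVolume_pos (d := d)
  simpa [measureReal_def, ENNReal.toReal_ofReal (mul_nonneg hV.le (pow_nonneg hR d))] using
    ENNReal.toReal_mono (measure_ne_top (law f) _) hmass

lemma measureReal_law_closedBall_le {a : E d} {l : ℝ≥0} (hR : 0 ≤ R)
    (h : ∀ z ∈ Metric.closedBall a R, f z ≤ l) :
    (law f).real (Metric.closedBall a R) ≤ l * (unitBallVolume d * R ^ d) := by
  have hmass := withDensity_le_mul_measure (μ := volume) (g := fun z => (f z : ℝ≥0∞)) (c := l)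
    measurableSet_closedBall fun z hz => ENNReal.coe_le_coe.2 (h z hz)
  rw [volume_closedBall_eq a hR] at hmass
  have hV := unitBallVolume_pos (d := d)
  simpa [measureReal_def, ENNReal.toReal_ofReal (mul_nonneg hV.le (pow_nonneg hR d))] using
    ENNReal.toReal_mono (by finiteness) hmass

lemma mul_le_two_mul_measureReal_law_inter [IsFiniteMeasure (law f)] {a b : E d} {l : ℝ≥0} {T : ℝ}
    (hR : 0 ≤ R) (hT : 0 ≤ T) (hab : R ^ 2 + dist a b ^ 2 ≤ T ^ 2)
    (h : ∀ z ∈ Metric.closedBall a R, l ≤ f z) :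
    l * (unitBallVolume d * R ^ d) ≤
      2 * (law f).real (Metric.closedBall a R ∩ Metric.closedBall b T) := by
  have hmass := mul_measure_le_withDensity (μ := volume) (g := fun z => (f z : ℝ≥0∞)) (c := l)
    (measurableSet_closedBall.inter measurableSet_closedBall)
    fun z (hz : z ∈ Metric.closedBall a R ∩ Metric.closedBall b T) =>
      ENNReal.coe_le_coe.2 (h z hz.1)
  have hlens : l * volume (Metric.closedBall a R) ≤
      2 * law f (Metric.closedBall a R ∩ Metric.closedBall b T) := by
    calc _ ≤ l * (2 * volume (Metric.closedBall a R ∩ Metric.closedBall b T)) := by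
          gcongr
          exact measure_closedBall_le_two_mul_measure_inter volume hT hab
      _ ≤ _ := by rw [mul_left_comm]; gcongr
  rw [volume_closedBall_eq a hR] at hlens
  have hV := unitBallVolume_pos (d := d)
  simpa [measureReal_def, ENNReal.toReal_ofReal (mul_nonneg hV.le (pow_nonneg hR d))] using
    ENNReal.toReal_mono (by finiteness) hlens

end Density

section Gaps

variable {d n : ℕ} {f : E d → ℝ≥0} {l : ℝ≥0} {η r₀ : ℝ} {a b p q z : E d}

/-- Around every point `a` in the interior of the region `l ≤ f`, the sample allows a step of
length at most `√2 * r₀` from any `b` in the closed ball of radius `s` around `a` into the open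
ball of radius `s` around `a`. This is what lets a chain of sample points follow a connected
set. -/
def FillsGaps (f : E d → ℝ≥0) (l : ℝ≥0) (r₀ s : ℝ) (x : Fin n → E d) : Prop :=
  ∀ a b, (∀ z ∈ Metric.closedBall a (2 * r₀), l ≤ f z) → dist b a ≤ s →
    ∃ j, dist (x j) a < s ∧ dist b (x j) ≤ √2 * r₀

/-- The target region of a step from `q` towards `p`; the margins proportional to `η` leave room
for replacing the points of `FillsGaps` by points of a finite `η * r₀`-net. -/
def lens (η r₀ : ℝ) (p q : E d) : Set (E d) :=
  Metric.closedBall p ((1 - 5 * η) * r₀) ∩ Metric.closedBall q ((√2 - η) * r₀)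

lemma measurableSet_lens : MeasurableSet (lens η r₀ p q) :=
  measurableSet_closedBall.inter measurableSet_closedBall

lemma dist_lt_and_dist_le_of_mem_lens (hη : 0 < η) (hr₀ : 0 < r₀) (hap : dist a p ≤ η * r₀)
    (hbq : dist b q ≤ η * r₀) (hz : z ∈ lens η r₀ p q) :
    dist z a < (1 - 3 * η) * r₀ ∧ dist b z ≤ √2 * r₀ := by
  have hzp : dist z p ≤ (1 - 5 * η) * r₀ := hz.1
  have hzq : dist z q ≤ (√2 - η) * r₀ := hz.2
  have hmargin : 0 < η * r₀ := mul_pos hη hr₀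
  constructor
  · linarith [dist_triangle_right z a p]
  · linarith [dist_triangle_right b z q]

lemma one_sub_five_mul_sq_add_one_sub_sq_le (hη₀ : 0 ≤ η) (hη₁ : η ≤ 1 / 10) :
    (1 - 5 * η) ^ 2 + (1 - η) ^ 2 ≤ (√2 - η) ^ 2 := by
  have hsq : √2 ^ 2 = 2 := Real.sq_sqrt two_pos.le
  have hle : √2 ≤ 2 := Real.sqrt_le_iff.2 (by norm_num)
  nlinarith

lemma le_measureReal_law_lens [IsFiniteMeasure (law f)] (hη₀ : 0 ≤ η) (hη₁ : η ≤ 1 / 10)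
    (hdη : d * (10 * η) ≤ 1) (hr₀ : 0 ≤ r₀) (hpq : dist p q ≤ (1 - η) * r₀)
    (h : ∀ z ∈ Metric.closedBall p ((1 - 5 * η) * r₀), l ≤ f z) :
    l * (unitBallVolume d * r₀ ^ d) / 4 ≤ (law f).real (lens η r₀ p q) := by
  have hsqrt : 1 ≤ √2 := Real.one_le_sqrt.2 one_le_two
  have hpyth : ((1 - 5 * η) * r₀) ^ 2 + dist p q ^ 2 ≤ ((√2 - η) * r₀) ^ 2 := calc
    _ ≤ ((1 - 5 * η) * r₀) ^ 2 + ((1 - η) * r₀) ^ 2 := by gcongr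
    _ = ((1 - 5 * η) ^ 2 + (1 - η) ^ 2) * r₀ ^ 2 := by ring
    _ ≤ ((√2 - η) * r₀) ^ 2 := by
      rw [mul_pow]
      gcongr
      exact one_sub_five_mul_sq_add_one_sub_sq_le hη₀ hη₁
  have hmass := mul_le_two_mul_measureReal_law_inter (mul_nonneg (by linarith) hr₀)
    (mul_nonneg (by linarith) hr₀) hpyth h
  have hbernoulli : 1 / 2 ≤ (1 - 5 * η) ^ d := by
    have := one_add_mul_le_pow (a := -(5 * η)) (by linarith) d
    rw [← sub_eq_add_neg] at this
    linarith
  have hV := unitBallVolume_pos (d := d)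
  have hhalf : 1 / 2 * (l * (unitBallVolume d * r₀ ^ d)) ≤
      (1 - 5 * η) ^ d * (l * (unitBallVolume d * r₀ ^ d)) := by gcongr
  rw [mul_pow] at hmass
  unfold lens
  linarith

lemma fillsGaps_of_forall_lens [IsFiniteMeasure (law f)] (hη₀ : 0 < η) (hη₁ : η ≤ 1 / 10)
    (hdη : d * (10 * η) ≤ 1) (hr₀ : 0 < r₀) {N : Set (E d)}
    (hN : ∀ c, (∀ z ∈ Metric.closedBall c (η * r₀ / 2), l ≤ f z) → ∃ p ∈ N, dist c p ≤ η * r₀)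
    {x : Fin n → E d}
    (hx : ∀ p ∈ N, ∀ q ∈ N, l * (unitBallVolume d * r₀ ^ d) / 4 ≤
      (law f).real (lens η r₀ p q) → ∃ j, x j ∈ lens η r₀ p q) :
    FillsGaps f l r₀ ((1 - 3 * η) * r₀) x := by
  intro a b hf hba
  have hmargin₀ : 0 < η * r₀ := mul_pos hη₀ hr₀
  have hmargin₁ : η * r₀ ≤ 1 / 10 * r₀ := by gcongr
  obtain ⟨p, hp, hap⟩ := hN a fun z hz =>
    hf z (Metric.closedBall_subset_closedBall (by linarith) hz)
  obtain ⟨q, hq, hbq⟩ := hN b fun z hz =>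
    hf z (Metric.closedBall_subset_closedBall' (by linarith) hz)
  have hpq : dist p q ≤ (1 - η) * r₀ := by
    linarith [dist_triangle4_left a b p q, dist_comm b a]
  obtain ⟨j, hj⟩ := hx p hp q hq <|
    le_measureReal_law_lens hη₀.le hη₁ hdη hr₀.le hpq fun z hz =>
      hf z (Metric.closedBall_subset_closedBall' (by linarith [dist_comm a p]) hz)
  exact ⟨j, dist_lt_and_dist_le_of_mem_lens hη₀ hr₀ hap hbq hj⟩

lemma measure_not_fillsGaps_le [IsProbabilityMeasure (law f)] (hη₀ : 0 < η) (hη₁ : η ≤ 1 / 10)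
    (hdη : d * (10 * η) ≤ 1) (hr₀ : 0 < r₀) (hl : 0 < l) (n : ℕ) :
    sampleLaw f n {x | ¬ FillsGaps f l r₀ ((1 - 3 * η) * r₀) x} ≤
      ENNReal.ofReal ((1 / (l * (unitBallVolume d * (η * r₀ / 2) ^ d))) ^ 2 *
        Real.exp (-(n * (l * (unitBallVolume d * r₀ ^ d) / 4)))) := by
  classical
  have hV := unitBallVolume_pos (d := d)
  have hm : 0 < l * (unitBallVolume d * (η * r₀ / 2) ^ d) := by positivity
  obtain ⟨N, hcard, hN⟩ := exists_finset_forall_dist_le (law f) (h := η * r₀) (by positivity) hm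
    (D := {c | ∀ z ∈ Metric.closedBall c (η * r₀ / 2), l ≤ f z})
    fun c hc => mul_le_measureReal_law_closedBall (by positivity) hc
  rw [probReal_univ, ← le_div_iff₀ hm] at hcard
  set T := (N ×ˢ N).filter fun e =>
    l * (unitBallVolume d * r₀ ^ d) / 4 ≤ (law f).real (lens η r₀ e.1 e.2)
  have hT : (T.card : ℝ) ≤ (1 / (l * (unitBallVolume d * (η * r₀ / 2) ^ d))) ^ 2 := calc
    (T.card : ℝ) ≤ (N ×ˢ N).card := by gcongr; exact Finset.filter_subset _ _
    _ = N.card ^ 2 := by rw [Finset.card_product, sq]; push_cast; rfl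
    _ ≤ _ := by gcongr
  calc sampleLaw f n {x | ¬ FillsGaps f l r₀ ((1 - 3 * η) * r₀) x}
      ≤ sampleLaw f n {x | ∃ e ∈ T, ∀ j, x j ∉ lens η r₀ e.1 e.2} := by
        refine measure_mono fun x hx => ?_
        by_contra hno
        refine hx (fillsGaps_of_forall_lens hη₀ hη₁ hdη hr₀ (N := N) hN fun p hp q hq hpq => ?_)
        by_contra! hempty
        exact hno ⟨(p, q), Finset.mem_filter.2 ⟨Finset.mk_mem_product hp hq, hpq⟩, hempty⟩
    _ ≤ ENNReal.ofReal (T.card * Real.exp (-(n * (l * (unitBallVolume d * r₀ ^ d) / 4)))) :=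
        measure_pi_exists_forall_notMem_le (law f) n T (fun _ => measurableSet_lens)
          fun e he => (Finset.mem_filter.1 he).2
    _ ≤ _ := by gcongr

end Gaps

section Graph

variable {d n k : ℕ} {x : Fin n → E d} {i : Fin n} {r r₀ : ℝ≥0} {v : Variant} {α : ℝ}

lemma knnRadius_le (h : k ≤ {j | x j ∈ Metric.closedBall (x i) r}.ncard) : knnRadius x k i ≤ r :=
  iInf₂_le r h

lemma le_knnRadius (h : {j | x j ∈ Metric.closedBall (x i) r}.ncard < k) :
    r ≤ knnRadius x k i := by
  refine le_iInf₂ fun r' hr' => ENNReal.coe_le_coe.2 ?_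
  by_contra! hlt
  exact (hr'.trans (Set.ncard_le_ncard fun _ hj =>
    (hj : _ ≤ (r' : ℝ)).trans (NNReal.coe_le_coe.2 hlt.le))).not_gt h

lemma lt_knnRadius (h : {j | x j ∈ Metric.closedBall (x i) r}.ncard < k) :
    r < knnRadius x k i := by
  have hempty : ∀ᶠ r' : ℝ≥0 in nhdsWithin r (Set.Ioi r),
      ∀ j, x j ∈ Metric.closedBall (x i) r' → x j ∈ Metric.closedBall (x i) r := by
    refine Filter.eventually_all.2 fun j => ?_
    by_cases hj : x j ∈ Metric.closedBall (x i) r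
    · exact .of_forall fun _ _ => hj
    · have hlt : r < nndist (x j) (x i) := not_le.1 hj
      filter_upwards [nhdsWithin_le_nhds (gt_mem_nhds hlt)] with r' hr' hj'
      exact absurd hj' (not_le.2 hr')
  obtain ⟨r', hr', hlt⟩ := (hempty.and self_mem_nhdsWithin).exists
  exact (ENNReal.coe_lt_coe.2 hlt).trans_le
    (le_knnRadius ((Set.ncard_le_ncard fun j hj => hr' j hj).trans_lt h))

lemma Variant.le_scale {a b c : ℝ≥0∞} (ha : c ≤ a) (hb : c ≤ b) : c ≤ v.scale a b := by
  cases v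
  · exact le_max_of_le_left ha
  · exact le_min ha hb

lemma Variant.scale_le {a b c : ℝ≥0∞} (ha : a ≤ c) (hb : b ≤ c) : v.scale a b ≤ c := by
  cases v
  · exact max_le ha hb
  · exact min_le_of_left_le ha

lemma reachable_nnGraph_of_dist_le {β : ℝ} (hα : β ≤ α) (hr₀ : ∀ i, r₀ ≤ knnRadius x k i)
    {i j : nodes x k r} (h : dist (x i) (x j) ≤ β * r₀) : (nnGraph v α k x r).Reachable i j := by
  rcases eq_or_ne i j with rfl | hij
  · exact .rfl
  refine SimpleGraph.Adj.reachable ((SimpleGraph.fromRel_adj _ _ _).2 ⟨hij, .inl ?_⟩)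
  calc edist (x i) (x j) ≤ ENNReal.ofReal (α * r₀) := by
        rw [edist_dist]
        exact ENNReal.ofReal_le_ofReal (h.trans (by gcongr))
    _ = ENNReal.ofReal α * r₀ := by
        rw [ENNReal.ofReal_mul' r₀.coe_nonneg, ENNReal.ofReal_coe_nnreal]
    _ ≤ _ := by
        gcongr
        exact Variant.le_scale (hr₀ i) (hr₀ j)

lemma dist_le_of_nnGraph_adj {β : ℝ} (hβ : 0 ≤ β) (hα : α ≤ β) {i j : nodes x k r}
    (h : (nnGraph v α k x r).Adj i j) : dist (x i) (x j) ≤ β * r := by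
  have hrel {i j : nodes x k r} (h : edist (x i) (x j) ≤
      ENNReal.ofReal α * v.scale (knnRadius x k i) (knnRadius x k j)) :
      dist (x i) (x j) ≤ β * r := by
    rw [← ENNReal.ofReal_le_ofReal_iff (by positivity), ← edist_dist, ENNReal.ofReal_mul hβ,
      ENNReal.ofReal_coe_nnreal]
    refine h.trans ?_
    gcongr
    exact Variant.scale_le i.2 j.2
  rcases ((SimpleGraph.fromRel_adj _ _ _).1 h).2 with h | h
  · exact hrel h
  · exact dist_comm (x i) (x j) ▸ hrel h

lemma joinedIn_diff_of_dist_le {F : Type*} [NormedAddCommGroup F] [NormedSpace ℝ F]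
    {X S : Set F} {a b : F} {r : ℝ} (hab : dist a b ≤ 2 * r) (hX : segment ℝ a b ⊆ X)
    (ha : ∀ s ∈ S, r < dist a s) (hb : ∀ s ∈ S, r < dist b s) : JoinedIn (X \ S) a b := by
  refine JoinedIn.of_segment_subset fun y hy => ⟨hX hy, fun hyS => ?_⟩
  linarith [dist_add_dist_of_mem_segment hy, dist_comm b y, ha y hyS, hb y hyS]

lemma disconnectedIn_nnGraph {σ : ℝ} {X S A A' : Set (E d)} (hα : α ≤ 2) (hX : ∀ i, x i ∈ X)
    (hconv : ConvexAtScale X σ) (hr : 2 * (r : ℝ) ≤ σ)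
    (hS : ∀ a ∈ A, ∀ a' ∈ A', ∀ γ : Path a a', (∀ t, γ t ∈ X) → ∃ t, γ t ∈ S)
    (hnear : ∀ i, ∀ s ∈ S, dist (x i) s ≤ r → r < knnRadius x k i) :
    DisconnectedIn x (nnGraph v α k x r) A A' := by
  have hfar (i : nodes x k r) : ∀ s ∈ S, r < dist (x i) s := fun s hs => by
    by_contra! hle
    exact (hnear i s hs hle).not_ge i.2
  have hjoined (i j : nodes x k r) (hij : dist (x i) (x j) ≤ 2 * r) :
      JoinedIn (X \ S) (x i) (x j) :=
    joinedIn_diff_of_dist_le hij (hconv _ (hX i) _ (hX j) (hij.trans hr)) (hfar i) (hfar j)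
  have hreach (i j : nodes x k r) (hij : (nnGraph v α k x r).Reachable i j) :
      JoinedIn (X \ S) (x i) (x j) := by
    obtain ⟨w⟩ := hij
    induction w with
    | nil => exact hjoined _ _ (by simp)
    | cons hadj _ ih => exact (hjoined _ _ (dist_le_of_nnGraph_adj two_pos.le hα hadj)).trans ih
  intro i j hi hj hij
  obtain ⟨γ, hγ⟩ := hreach i j hij
  obtain ⟨t, ht⟩ := hS _ hi _ hj γ fun t => (hγ t).1
  exact (hγ t).2 ht

/-- The points of `A` within distance `s` of the connected component of `i` form a clopen subset
of `A`. -/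
lemma exists_reachable_dist_le_of_isPreconnected {V Y : Type*} [Finite V] [PseudoMetricSpace Y]
    {G : SimpleGraph V} {y : V → Y} {s : ℝ} {A : Set Y} (hA : IsPreconnected A)
    (hstep : ∀ a ∈ A, ∀ i, dist (y i) a ≤ s → ∃ j, G.Reachable i j ∧ dist (y j) a < s)
    {i : V} {a b : Y} (ha : a ∈ A) (hb : b ∈ A) (hia : dist (y i) a ≤ s) :
    ∃ j, G.Reachable i j ∧ dist (y j) b ≤ s := by
  set T : Set A := {c | ∃ j, G.Reachable i j ∧ dist (y j) c ≤ s}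
  have hclosed : IsClosed T := by
    have hT : T = ⋃ j ∈ {j | G.Reachable i j}, {c : A | dist (y j) c ≤ s} := by
      ext; simp [T]
    rw [hT]
    exact Set.Finite.isClosed_biUnion (Set.toFinite _) fun j _ =>
      isClosed_le (by fun_prop) continuous_const
  have hopen : IsOpen T := by
    refine isOpen_iff_mem_nhds.2 fun c ⟨j, hij, hjc⟩ => ?_
    obtain ⟨j', hjj', hlt⟩ := hstep c c.2 j hjc
    have hcont : Continuous fun c : A => dist (y j') c := by fun_prop
    filter_upwards [hcont.continuousAt.eventually (gt_mem_nhds hlt)] with c' hc'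
    exact ⟨j', hij.trans hjj', hc'.le⟩
  have : PreconnectedSpace A := Subtype.preconnectedSpace hA
  have huniv : T = Set.univ := IsClopen.eq_univ ⟨hclosed, hopen⟩ ⟨⟨a, ha⟩, i, .rfl, hia⟩
  exact huniv.ge (Set.mem_univ (⟨b, hb⟩ : A))

lemma connectedIn_nnGraph {s : ℝ} {A : Set (E d)} (hα : √2 ≤ α) (hs₀ : 0 ≤ s)
    (hs : s ≤ √2 * r₀) (hA : IsPreconnected A)
    (hnode : ∀ a ∈ A, ∀ i, dist (x i) a ≤ s → i ∈ nodes x k r)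
    (hr₀ : ∀ i, r₀ ≤ knnRadius x k i)
    (hstep : ∀ a ∈ A, ∀ i, dist (x i) a ≤ s →
      ∃ j, dist (x j) a < s ∧ dist (x i) (x j) ≤ √2 * r₀) :
    ConnectedIn x (nnGraph v α k x r) A := by
  intro i j hi hj
  have hiV : i ∈ nodes x k r := hnode _ hi i (by simpa using hs₀)
  have hjV : j ∈ nodes x k r := hnode _ hj j (by simpa using hs₀)
  obtain ⟨q, hiq, hqj⟩ := exists_reachable_dist_le_of_isPreconnected
    (G := nnGraph v α k x r) (y := fun q => x q) (s := s) hA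
    (fun a ha q hqa => by
      obtain ⟨q', hq'a, hqq'⟩ := hstep a ha q hqa
      exact ⟨⟨q', hnode a ha q' hq'a.le⟩, reachable_nnGraph_of_dist_le hα hr₀ hqq', hq'a⟩)
    hi hj (i := ⟨i, hiV⟩) (by simpa using hs₀)
  exact ⟨hiV, hjV, hiq.trans (reachable_nnGraph_of_dist_le hα hr₀ (hqj.trans hs))⟩

end Graph

section Numerics

variable {d n : ℕ} {δ L Q m y : ℝ}

lemma log_two_le_log_two_div (hδ₀ : 0 < δ) (hδ₁ : δ ≤ 1) : Real.log 2 ≤ Real.log (2 / δ) :=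
  Real.log_le_log two_pos ((le_div_iff₀ hδ₀).2 (by linarith))

lemma exp_neg_two_mul_log_two_div_le (hδ₀ : 0 < δ) (hδ₁ : δ ≤ 1) :
    Real.exp (-(2 * Real.log (2 / δ))) ≤ δ / 4 := calc
  Real.exp (-(2 * Real.log (2 / δ))) = (δ / 2) ^ 2 := by
    rw [← Real.exp_log (show 0 < (δ / 2) ^ 2 by positivity), Real.log_pow, ← inv_div, Real.log_inv]
    push_cast
    ring_nf
  _ ≤ δ / 4 := by nlinarith

lemma natCast_mul_exp_one_sub_le (hn : 2 ≤ n) (hQ : Real.log n ≤ Q) (hL : Real.log 2 ≤ L)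
    (hy : 1000 * Q * L ^ 2 ≤ y) : n * Real.exp (1 - y / 48) ≤ Real.exp (-(2 * L)) := by
  have hlog2 : 0.69 < Real.log 2 := by linarith [Real.log_two_gt_d9]
  have hn' : (2 : ℝ) ≤ n := by exact_mod_cast hn
  have hlogn : Real.log 2 ≤ Real.log n := Real.log_le_log two_pos hn'
  have hLsq : 0.69 * L ≤ L ^ 2 := by nlinarith
  have hQLsq : 0.47 * Q ≤ Q * L ^ 2 := by nlinarith
  have hLQsq : 0.69 * L ^ 2 ≤ Q * L ^ 2 := by nlinarith [sq_nonneg L]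
  calc n * Real.exp (1 - y / 48) = Real.exp (Real.log n + (1 - y / 48)) := by
        rw [Real.exp_add, Real.exp_log (by linarith)]
    _ ≤ Real.exp (-(2 * L)) := Real.exp_le_exp.2 (by linarith)

lemma twenty_mul_le (hn : 2 ≤ n) (hL : Real.log 2 ≤ L)
    (hy : 1000 * (d * Real.log n) * L ^ 2 ≤ y) : 20 * (d : ℝ) ≤ y := by
  have hlog2 : 0.69 < Real.log 2 := by linarith [Real.log_two_gt_d9]
  have hlogn : Real.log 2 ≤ Real.log n := Real.log_le_log two_pos (by exact_mod_cast hn)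
  have hprod : d * 0.69 * 0.69 ^ 2 ≤ d * Real.log n * L ^ 2 := by gcongr <;> linarith
  linarith [d.cast_nonneg (α := ℝ)]

lemma div_sq_mul_exp_le (hd : 0 < d) (hn : 2 ≤ n) (hdn : 20 * (d : ℝ) ≤ n) (hL : Real.log 2 ≤ L)
    (hm : 500 * (d * Real.log n) * L ≤ n * m) :
    ((20 * (d : ℝ)) ^ d / m) ^ 2 * Real.exp (-(n * (m / 4))) ≤ Real.exp (-(2 * L)) := by
  have hlog2 : 0.69 < Real.log 2 := by linarith [Real.log_two_gt_d9]
  have hn' : (2 : ℝ) ≤ n := by exact_mod_cast hn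
  have hd' : (1 : ℝ) ≤ d := by exact_mod_cast hd
  have hlogn : Real.log 2 ≤ Real.log n := Real.log_le_log two_pos hn'
  have hQ : Real.log n ≤ d * Real.log n := by nlinarith
  have hQL : 0.69 * (d * Real.log n) ≤ d * Real.log n * L := by nlinarith
  have hLQ : 0.69 * L ≤ d * Real.log n * L := by nlinarith
  have hnm : 1 ≤ n * m := by linarith
  have hm₀ : 0 < m := pos_of_mul_pos_right (by linarith : 0 < n * m) (by linarith)
  have hcard : (20 * (d : ℝ)) ^ d / m ≤ Real.exp ((d + 1) * Real.log n) := calc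
    (20 * (d : ℝ)) ^ d / m ≤ n ^ d * n := by
      rw [div_le_iff₀ hm₀, mul_assoc]
      exact (pow_le_pow_left₀ (by positivity) hdn d).trans
        (le_mul_of_one_le_right (by positivity) hnm)
    _ = Real.exp ((d + 1) * Real.log n) := by
      rw [add_mul, one_mul, Real.exp_add, Real.exp_nat_mul, Real.exp_log (by linarith)]
  calc ((20 * (d : ℝ)) ^ d / m) ^ 2 * Real.exp (-(n * (m / 4)))
      ≤ Real.exp ((d + 1) * Real.log n) ^ 2 * Real.exp (-(n * (m / 4))) := by gcongr
    _ = Real.exp (2 * ((d + 1) * Real.log n) - n * (m / 4)) := by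
        rw [← Real.exp_nat_mul, ← Real.exp_add]
        push_cast
        ring_nf
    _ ≤ Real.exp (-(2 * L)) := Real.exp_le_exp.2 (by linarith)

end Numerics

section Typical

variable {d n k : ℕ} {δ ε σ α : ℝ} {f : E d → ℝ≥0} {X : Set (E d)} {l r₀ r Λ : ℝ≥0}
  {x : Fin n → E d} {v : Variant}

/-- The properties of the sample on which the structure of the graph rests. The radius `r₀` will be
a lower bound for all `k`-nearest-neighbour radii. -/
structure IsTypical (f : E d → ℝ≥0) (X : Set (E d)) (k : ℕ) (ε : ℝ) (l r₀ : ℝ≥0)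
    (x : Fin n → E d) : Prop where
  mem : ∀ i, x i ∈ X
  concentratedCounts : ConcentratedCounts (law f) k ε x
  fillsGaps : FillsGaps f l r₀ ((1 - 3 * (1 / (10 * d))) * r₀) x

lemma measure_not_fillsGaps_one_div_le [IsProbabilityMeasure (law f)] (hd : 0 < d) (hr₀ : 0 < r₀)
    (hl : 0 < l) (n : ℕ) :
    sampleLaw f n {x | ¬ FillsGaps f l r₀ ((1 - 3 * (1 / (10 * d))) * r₀) x} ≤
      ENNReal.ofReal (((20 * d) ^ d / (l * (unitBallVolume d * r₀ ^ d))) ^ 2 *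
        Real.exp (-(n * (l * (unitBallVolume d * r₀ ^ d) / 4)))) := by
  have hd' : (1 : ℝ) ≤ d := by exact_mod_cast hd
  have hη : 1 / (10 * d) ≤ (1 / 10 : ℝ) := by gcongr; linarith
  have hnet : 1 / (10 * d) * r₀ / 2 = (r₀ / (20 * d) : ℝ) := by field_simp; norm_num
  have hcard : 1 / (l * (unitBallVolume d * (r₀ / (20 * d)) ^ d)) =
      (20 * d) ^ d / (l * (unitBallVolume d * r₀ ^ d) : ℝ) := by
    rw [div_pow]
    field_simp
  have h := measure_not_fillsGaps_le (f := f) (η := 1 / (10 * d)) (r₀ := r₀) (by positivity) hη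
    (by field_simp; rfl) hr₀ hl n
  rwa [hnet, hcard] at h

lemma measure_not_isTypical_le (hf : IsDensityOn f X) (hd : 0 < d) (hk : 0 < k) (hδ₀ : 0 < δ)
    (hδ₁ : δ ≤ 1) (hε₀ : 0 < ε) (hε₁ : ε < 1) (hkn : k * (1 + ε / 2) ≤ n)
    (hC : 1000 * (d * Real.log n / ε ^ 2) * Real.log (2 / δ) ^ 2 ≤ k) (hr₀ : 0 < r₀) (hl : 0 < l)
    (hm : 500 * (d * Real.log n) * Real.log (2 / δ) ≤ n * (l * (unitBallVolume d * r₀ ^ d))) :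
    sampleLaw f n {x | ¬ IsTypical f X k ε l r₀ x} ≤ ENNReal.ofReal δ := by
  have := hf.isProbabilityMeasure
  have hk' : (1 : ℝ) ≤ k := by exact_mod_cast hk
  have hd' : (1 : ℝ) ≤ d := by exact_mod_cast hd
  have hkn' : (k : ℝ) ≤ n := by nlinarith
  have hn : 2 ≤ n := by exact_mod_cast (by nlinarith : (1 : ℝ) < n)
  have hL := log_two_le_log_two_div hδ₀ hδ₁
  have hexp := exp_neg_two_mul_log_two_div_le hδ₀ hδ₁
  have hlogn : 0 ≤ Real.log n := Real.log_natCast_nonneg n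
  have hy : 1000 * (d * Real.log n) * Real.log (2 / δ) ^ 2 ≤ k * ε ^ 2 := by
    rwa [← mul_div_assoc, div_mul_eq_mul_div, div_le_iff₀ (by positivity)] at hC
  have hkε : k * ε ^ 2 ≤ k := mul_le_of_le_one_right (by positivity) (by nlinarith)
  have hdn : 20 * (d : ℝ) ≤ n := (twenty_mul_le hn hL hy).trans (hkε.trans hkn')
  have hmem : sampleLaw f n {x | ¬ ∀ i, x i ∈ X} ≤ 0 := (ae_iff.1 (hf.ae_forall_mem n)).le
  have hcounts : sampleLaw f n {x | ¬ ConcentratedCounts (law f) k ε x} ≤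
      ENNReal.ofReal (δ / 2) :=
    (measure_not_concentratedCounts_le (law_sphere_eq_zero hd f) hk hε₀ hε₁ hkn).trans
      (ENNReal.ofReal_le_ofReal (by
        linarith [natCast_mul_exp_one_sub_le hn (by nlinarith) hL hy]))
  have hgaps : sampleLaw f n {x | ¬ FillsGaps f l r₀ ((1 - 3 * (1 / (10 * d))) * r₀) x} ≤
      ENNReal.ofReal (δ / 2) :=
    (measure_not_fillsGaps_one_div_le hd hr₀ hl n).trans
      (ENNReal.ofReal_le_ofReal (by linarith [div_sq_mul_exp_le hd hn hdn hL hm]))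
  calc sampleLaw f n {x | ¬ IsTypical f X k ε l r₀ x}
      ≤ sampleLaw f n ({x | ¬ ∀ i, x i ∈ X} ∪ {x | ¬ ConcentratedCounts (law f) k ε x} ∪
          {x | ¬ FillsGaps f l r₀ ((1 - 3 * (1 / (10 * d))) * r₀) x}) := by
        refine measure_mono fun x hx => ?_
        by_contra hno
        simp only [Set.mem_union, Set.mem_ofPred_eq, not_or, not_not] at hno
        exact hx ⟨hno.1.1, hno.1.2, hno.2⟩
    _ ≤ 0 + ENNReal.ofReal (δ / 2) + ENNReal.ofReal (δ / 2) :=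
        (measure_union_le _ _).trans (add_le_add ((measure_union_le _ _).trans
          (add_le_add hmem hcounts)) hgaps)
    _ = ENNReal.ofReal δ := by
        rw [zero_add, ← ENNReal.ofReal_add (by positivity) (by positivity), add_halves]

lemma ConcentratedCounts.mem_nodes [IsFiniteMeasure (law f)]
    (hx : ConcentratedCounts (law f) k ε x) {i : Fin n}
    (hr : k / n * (1 + ε / 2) ≤ l * (unitBallVolume d * r ^ d))
    (hl : ∀ z ∈ Metric.closedBall (x i) r, l ≤ f z) : i ∈ nodes x k r :=
  knnRadius_le (hx.le_ncard i r (hr.trans (mul_le_measureReal_law_closedBall r.coe_nonneg hl)))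

lemma ConcentratedCounts.lt_knnRadius (hx : ConcentratedCounts (law f) k ε x) {i : Fin n}
    (hr : l * (unitBallVolume d * r ^ d) ≤ k / n * (1 - ε / 2))
    (hl : ∀ z ∈ Metric.closedBall (x i) r, f z ≤ l) : r < knnRadius x k i :=
  ClusterTree.lt_knnRadius
    (hx.ncard_lt i r ((measureReal_law_closedBall_le r.coe_nonneg hl).trans hr))

lemma IsTypical.connectedIn [IsFiniteMeasure (law f)] (hx : IsTypical f X k ε l r₀ x) (hd : 0 < d)
    (hα : √2 ≤ α) (hΛ : ∀ y, f y ≤ Λ)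
    (hr₀ : Λ * (unitBallVolume d * r₀ ^ d) ≤ k / n * (1 - ε / 2)) {lev : ℝ≥0} (hlev : l ≤ lev)
    (hr : k / n * (1 + ε / 2) ≤ lev * (unitBallVolume d * r ^ d)) (hr₀r : (r₀ : ℝ) ≤ r)
    (hrσ : 2 * (r : ℝ) ≤ σ) {A : Set (E d)} (hA : IsPreconnected A)
    (hAlev : ∀ z ∈ Metric.cthickening σ A, lev ≤ f z) :
    ConnectedIn x (nnGraph v α k x r) A := by
  have hd' : (1 : ℝ) ≤ d := by exact_mod_cast hd
  have hs₀ : 0 ≤ 1 - 3 * (1 / (10 * d) : ℝ) := by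
    rw [sub_nonneg, mul_one_div, div_le_one (by positivity)]
    linarith
  have hs : (1 - 3 * (1 / (10 * d))) * r₀ ≤ (r₀ : ℝ) :=
    mul_le_of_le_one_left r₀.coe_nonneg (sub_le_self _ (by positivity))
  refine connectedIn_nnGraph hα (mul_nonneg hs₀ r₀.coe_nonneg)
    (hs.trans (le_mul_of_one_le_left r₀.coe_nonneg (Real.one_le_sqrt.2 one_le_two))) hA ?_
    (fun i => (hx.concentratedCounts.lt_knnRadius hr₀ fun z _ => hΛ z).le) ?_
  · exact fun a ha i hi => hx.concentratedCounts.mem_nodes hr fun z hz =>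
      hAlev z (Metric.closedBall_subset_cthickening ha σ
        (Metric.closedBall_subset_closedBall' (by linarith) hz))
  · exact fun a ha i hi => hx.fillsGaps a (x i) (fun z hz => hlev.trans
      (hAlev z (Metric.closedBall_subset_cthickening ha σ
        (Metric.closedBall_subset_closedBall (by linarith) hz)))) hi

lemma IsTypical.disconnectedIn (hx : IsTypical f X k ε l r₀ x) (hε₁ : ε ≤ 1) (hα : α ≤ 2)
    (hconv : ConvexAtScale X σ) {A A' : Set (E d)} (hsep : Separated X f σ ε A A')
    (hr : unitBallVolume d * r ^ d * level f σ A A' ≤ k / n * (1 + ε / 2))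
    (hrσ : 2 * (r : ℝ) ≤ σ) : DisconnectedIn x (nnGraph v α k x r) A A' := by
  obtain ⟨S, -, hS, hlow⟩ := hsep
  have hε : 0 ≤ 1 - ε := by linarith
  refine disconnectedIn_nnGraph hα hx.mem hconv hrσ hS fun i s hs his =>
    hx.concentratedCounts.lt_knnRadius (l := (1 - ε).toNNReal * level f σ A A') ?_ fun z hz => ?_
  · rw [NNReal.coe_mul, Real.coe_toNNReal _ hε]
    calc (1 - ε) * level f σ A A' * (unitBallVolume d * r ^ d)
        = (1 - ε) * (unitBallVolume d * r ^ d * level f σ A A') := by ring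
      _ ≤ (1 - ε) * (k / n * (1 + ε / 2)) := by gcongr
      _ = k / n * (1 - ε / 2 - ε ^ 2 / 2) := by ring
      _ ≤ k / n * (1 - ε / 2) := by
          refine mul_le_mul_of_nonneg_left ?_ (by positivity)
          exact sub_le_self _ (by positivity)
  · have hz : z ∈ Metric.cthickening σ S := Metric.closedBall_subset_cthickening hs σ
      (Metric.closedBall_subset_closedBall' (by linarith) hz)
    refine ENNReal.coe_le_coe.1 ?_
    rw [ENNReal.coe_mul]
    exact (le_iSup₂ (f := fun y (_ : y ∈ Metric.cthickening σ S) => (f y : ℝ≥0∞)) z hz).trans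
      hlow.le

end Typical

section Resolution

variable {d n k : ℕ} {δ ε σ : ℝ} {f : E d → ℝ≥0} {X A A' : Set (E d)}

lemma level_le {z : E d} (hz : z ∈ Metric.cthickening σ A ∪ Metric.cthickening σ A') :
    level f σ A A' ≤ f z :=
  csInf_le (OrderBot.bddBelow _) (Set.mem_image_of_mem f hz)

lemma Separated.level_pos (h : Separated X f σ ε A A') : 0 < level f σ A A' := by
  obtain ⟨S, -, -, hlow⟩ := h
  refine pos_iff_ne_zero.2 fun h₀ => ?_
  simp [h₀] at hlow

lemma IsDensityOn.le_of_iSup_eq (hf : IsDensityOn f X) {Λ : ℝ≥0}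
    (hΛ : ⨆ y ∈ X, (f y : ℝ≥0∞) = Λ) (y : E d) : f y ≤ Λ := by
  by_cases hy : y ∈ X
  · exact ENNReal.coe_le_coe.1 (hΛ ▸ le_iSup₂ (f := fun y (_ : y ∈ X) => (f y : ℝ≥0∞)) y hy)
  · exact hf.eq_zero_of_notMem y hy ▸ zero_le

/-- The radius of the nearest-neighbour graph that represents the level `l`: the balls of this
radius on which the density is `l` contain `k * (1 + ε / 2)` sample points on average. -/
noncomputable def levelRadius (d n k : ℕ) (ε : ℝ) (l : ℝ≥0) : ℝ≥0 :=
  volumeRadius d (k / n * (1 + ε / 2) / l)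

/-- A lower bound for all `k`-nearest-neighbour radii in a sample from a density bounded by `Λ`:
the balls of this radius contain at most `k / 2` sample points on average. -/
noncomputable def minRadius (d n k : ℕ) (Λ : ℝ≥0) : ℝ≥0 :=
  volumeRadius d (k / (2 * n) / Λ)

/-- The least level at which clusters of a density bounded by `Λ` are resolved, read off from the
hypothesis `k ≥ Λ / λ * C d log n log (2 / δ)`. -/
noncomputable def minLevel (d n k : ℕ) (δ : ℝ) (Λ : ℝ≥0) : ℝ≥0 :=
  (1000 * d * Real.log n * Real.log (2 / δ) * Λ / k).toNNReal

lemma unitBallVolume_mul_levelRadius_pow_mul (hd : 0 < d) (hε : 0 ≤ ε) {l : ℝ≥0} (hl : 0 < l) :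
    unitBallVolume d * (levelRadius d n k ε l : ℝ) ^ d * l = k / n * (1 + ε / 2) := by
  rw [levelRadius, unitBallVolume_mul_volumeRadius_pow hd (by positivity),
    div_mul_cancel₀ _ (NNReal.coe_pos.2 hl).ne']

lemma mul_unitBallVolume_mul_minRadius_pow (hd : 0 < d) {Λ : ℝ≥0} (hΛ : 0 < Λ) :
    Λ * (unitBallVolume d * (minRadius d n k Λ : ℝ) ^ d) = k / (2 * n) := by
  rw [minRadius, unitBallVolume_mul_volumeRadius_pow hd (by positivity),
    mul_div_cancel₀ _ (NNReal.coe_pos.2 hΛ).ne']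

lemma minRadius_le_levelRadius (hd : 0 < d) (hε : 0 ≤ ε) {l Λ : ℝ≥0} (hl : 0 < l) (hlΛ : l ≤ Λ) :
    (minRadius d n k Λ : ℝ) ≤ levelRadius d n k ε l := by
  refine volumeRadius_le hd (by positivity) NNReal.zero_le_coe ?_
  rw [levelRadius, unitBallVolume_mul_volumeRadius_pow hd (by positivity)]
  gcongr
  calc (k / (2 * n) : ℝ) = k / n * (1 / 2) := by ring
    _ ≤ k / n * (1 + ε / 2) := by gcongr; linarith

lemma minRadius_pos (hn : 0 < n) (hk : 0 < k) {Λ : ℝ≥0} (hΛ : 0 < Λ) :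
    0 < minRadius d n k Λ := by
  have hV := unitBallVolume_pos (d := d)
  exact Real.toNNReal_pos.2 (by positivity)

lemma minLevel_pos (hd : 0 < d) (hn : 1 < n) (hk : 0 < k) (hδ₀ : 0 < δ) (hδ₁ : δ ≤ 1) {Λ : ℝ≥0}
    (hΛ : 0 < Λ) : 0 < minLevel d n k δ Λ := by
  have hlog : 0 < Real.log n := Real.log_pos (by exact_mod_cast hn)
  have hL : 0 < Real.log (2 / δ) :=
    (Real.log_pos one_lt_two).trans_le (log_two_le_log_two_div hδ₀ hδ₁)
  exact Real.toNNReal_pos.2 (by positivity)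

lemma le_mul_minLevel_mul_minRadius_pow (hd : 0 < d) (hn : 0 < n) (hk : 0 < k) {Λ : ℝ≥0}
    (hΛ : 0 < Λ) :
    500 * (d * Real.log n) * Real.log (2 / δ) ≤
      n * (minLevel d n k δ Λ * (unitBallVolume d * (minRadius d n k Λ : ℝ) ^ d)) := by
  have hV := unitBallVolume_pos (d := d)
  calc 500 * (d * Real.log n) * Real.log (2 / δ)
      = n * (1000 * d * Real.log n * Real.log (2 / δ) * Λ / k *
          (unitBallVolume d * (minRadius d n k Λ : ℝ) ^ d)) := by
        rw [mul_div_right_comm _ (Λ : ℝ), mul_assoc (_ / _),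
          mul_unitBallVolume_mul_minRadius_pow hd hΛ]
        field_simp
        ring
    _ ≤ _ := by
        gcongr
        exact Real.le_coe_toNNReal _

/-- The sets `A`, `A'` are separated, and salient enough to be resolved at scale `σ` by the
`k`-nearest-neighbour graphs of a sample of size `n`. -/
structure Resolvable (X : Set (E d)) (f : E d → ℝ≥0) (n k : ℕ) (δ ε σ : ℝ) (A A' : Set (E d)) :
    Prop where
  pos : 0 < σ
  convexAtScale : ConvexAtScale X σ
  isConnected_left : IsConnected A
  isConnected_right : IsConnected A'
  separated : Separated X f σ ε A A'
  sampleSize_ge :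
    (k : ℝ) / (unitBallVolume d * (σ / 2) ^ d * (level f σ A A' : ℝ)) * (1 + ε / 2) ≤ n
  neighbours_ge :
    (⨆ y ∈ X, (f y : ℝ≥0∞)) / (level f σ A A' : ℝ≥0∞) *
      ENNReal.ofReal (1000 * d * Real.log n * Real.log (2 / δ)) ≤ (k : ℝ≥0∞)

namespace Resolvable

lemma mul_le_mul_unitBallVolume (h : Resolvable X f n k δ ε σ A A') :
    k * (1 + ε / 2) ≤ n * (unitBallVolume d * (σ / 2) ^ d * level f σ A A') := by
  have hV := unitBallVolume_pos (d := d)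
  have hlev : (0 : ℝ) < level f σ A A' := NNReal.coe_pos.2 h.separated.level_pos
  have hσ := h.pos
  have := h.sampleSize_ge
  rwa [div_mul_eq_mul_div, div_le_iff₀ (by positivity)] at this

lemma mul_le_sampleSize [IsProbabilityMeasure (law f)] (h : Resolvable X f n k δ ε σ A A') :
    k * (1 + ε / 2) ≤ n := by
  obtain ⟨a, ha⟩ := h.isConnected_left.nonempty
  have hσ := h.pos
  have hball : level f σ A A' * (unitBallVolume d * (σ / 2) ^ d) ≤
      (law f).real (Metric.closedBall a (σ / 2)) :=
    mul_le_measureReal_law_closedBall (by positivity) fun z hz =>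
      level_le (.inl (Metric.closedBall_subset_cthickening ha σ
        (Metric.closedBall_subset_closedBall (by linarith) hz)))
  refine h.mul_le_mul_unitBallVolume.trans (mul_le_of_le_one_right n.cast_nonneg ?_)
  linarith [measureReal_le_one (μ := law f) (s := Metric.closedBall a (σ / 2))]

lemma two_mul_levelRadius_le (h : Resolvable X f n k δ ε σ A A') (hd : 0 < d) (hn : 0 < n)
    (hε : 0 < ε) :
    2 * (levelRadius d n k ε (level f σ A A') : ℝ) ≤ σ := by
  have hσ := h.pos
  have hlev : (0 : ℝ) < level f σ A A' := NNReal.coe_pos.2 h.separated.level_pos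
  have hn' : (0 : ℝ) < n := Nat.cast_pos.2 hn
  have := volumeRadius_le hd (by positivity) (half_pos hσ).le
    (a := k / n * (1 + ε / 2) / level f σ A A') (by
      rw [div_le_iff₀ hlev, div_mul_eq_mul_div, div_le_iff₀' hn']
      exact h.mul_le_mul_unitBallVolume)
  rw [levelRadius]
  linarith

lemma level_le_of_forall_le (h : Resolvable X f n k δ ε σ A A') {Λ : ℝ≥0} (hΛ : ∀ y, f y ≤ Λ) :
    level f σ A A' ≤ Λ :=
  have ⟨a, ha⟩ := h.isConnected_left.nonempty
  (level_le (.inl (Metric.self_subset_cthickening A ha))).trans (hΛ a)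

lemma iSup_density_ne_top (h : Resolvable X f n k δ ε σ A A') (hd : 0 < d) (hn : 1 < n)
    (hδ₀ : 0 < δ) (hδ₁ : δ ≤ 1) : ⨆ y ∈ X, (f y : ℝ≥0∞) ≠ ⊤ := by
  intro htop
  have hlog : 0 < Real.log n := Real.log_pos (by exact_mod_cast hn)
  have hL : 0 < Real.log (2 / δ) :=
    (Real.log_pos one_lt_two).trans_le (log_two_le_log_two_div hδ₀ hδ₁)
  have := h.neighbours_ge
  rw [htop, ENNReal.top_div_coe,
    ENNReal.top_mul (ENNReal.ofReal_pos.2 (by positivity)).ne', top_le_iff] at this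
  exact ENNReal.natCast_ne_top k this

lemma minLevel_le_level {Λ : ℝ≥0} (h : Resolvable X f n k δ ε σ A A') (hk : 0 < k)
    (hΛ : ⨆ y ∈ X, (f y : ℝ≥0∞) = Λ) :
    minLevel d n k δ Λ ≤ level f σ A A' := by
  have hlev := h.separated.level_pos
  have := h.neighbours_ge
  rw [hΛ, ← ENNReal.coe_div hlev.ne', ENNReal.ofReal, ← ENNReal.coe_mul, ← ENNReal.coe_natCast,
    ENNReal.coe_le_coe, ← NNReal.coe_le_coe] at this
  push_cast at this
  refine Real.toNNReal_le_iff_le_coe.2 ((div_le_iff₀ (by positivity)).2 ?_)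
  rw [div_mul_eq_mul_div, div_le_iff₀ (by positivity), mul_comm] at this
  exact (mul_le_mul_of_nonneg_right (Real.le_coe_toNNReal _) Λ.coe_nonneg).trans
    (this.trans_eq (mul_comm _ _))

lemma disconnectedIn_and_connectedIn (h : Resolvable X f n k δ ε σ A A') (hf : IsDensityOn f X)
    (hd : 0 < d) (hn : 0 < n) (hk : 0 < k) (hε₀ : 0 < ε) (hε₁ : ε ≤ 1) {Λ : ℝ≥0}
    (hΛ : ⨆ y ∈ X, (f y : ℝ≥0∞) = Λ) {x : Fin n → E d}
    (hx : IsTypical f X k ε (minLevel d n k δ Λ) (minRadius d n k Λ) x) {v : Variant} {α : ℝ}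
    (hα₁ : √2 ≤ α) (hα₂ : α ≤ 2) :
    DisconnectedIn x (nnGraph v α k x (levelRadius d n k ε (level f σ A A'))) A A' ∧
      ConnectedIn x (nnGraph v α k x (levelRadius d n k ε (level f σ A A'))) A ∧
      ConnectedIn x (nnGraph v α k x (levelRadius d n k ε (level f σ A A'))) A' := by
  have := hf.isProbabilityMeasure
  have hfΛ := hf.le_of_iSup_eq hΛ
  have hlev := h.separated.level_pos
  have hlevΛ := h.level_le_of_forall_le hfΛ
  have hrσ := h.two_mul_levelRadius_le hd hn hε₀
  have hr := unitBallVolume_mul_levelRadius_pow_mul (n := n) (k := k) hd hε₀.le hlev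
  have hmin : Λ * (unitBallVolume d * minRadius d n k Λ ^ d) ≤ k / n * (1 - ε / 2) := calc
    _ = k / n * (1 / 2 : ℝ) := by
      rw [mul_unitBallVolume_mul_minRadius_pow hd (hlev.trans_le hlevΛ)]
      ring
    _ ≤ _ := by gcongr; linarith
  have hconn {B : Set (E d)} (hB : IsConnected B)
      (hBA : Metric.cthickening σ B ⊆ Metric.cthickening σ A ∪ Metric.cthickening σ A') :
      ConnectedIn x (nnGraph v α k x (levelRadius d n k ε (level f σ A A'))) B :=
    hx.connectedIn hd hα₁ hfΛ hmin (h.minLevel_le_level hk hΛ) (by linarith)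
      (minRadius_le_levelRadius hd hε₀.le hlev hlevΛ) hrσ hB.isPreconnected
      fun z hz => level_le (hBA hz)
  exact ⟨hx.disconnectedIn hε₁ hα₂ h.convexAtScale h.separated hr.le hrσ,
    hconn h.isConnected_left Set.subset_union_left,
    hconn h.isConnected_right Set.subset_union_right⟩

end Resolvable

end Resolution

end ClusterTree

open ClusterTree in
theorem theorem2_general (d n k : ℕ) (δ ε : ℝ) (X : Set (E d)) (f : E d → ℝ≥0) (hd : 0 < d)
    (hn : 0 < n) (hk : 0 < k) (hδ₀ : 0 < δ) (hδ₁ : δ < 1) (hε₀ : 0 < ε) (hε₁ : ε < 1)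
    (hf : IsDensityOn f X)
    (hC : 1000 * (d * Real.log n / ε ^ 2) * Real.log (2 / δ) ^ 2 ≤ k) :
    ∃ r : ℝ≥0 → ℝ≥0,
      (∀ l : ℝ≥0, 0 < l → (k / n : ℝ) ≤ unitBallVolume d * (r l : ℝ) ^ d * l ∧
        unitBallVolume d * (r l : ℝ) ^ d * l ≤ (k / n : ℝ) * (1 + ε / 2)) ∧
      ∃ Ω : Set (Fin n → E d), MeasurableSet Ω ∧ ENNReal.ofReal (1 - δ) ≤ sampleLaw f n Ω ∧
        ∀ x ∈ Ω, ∀ (σ : ℝ) (A A' : Set (E d)), Resolvable X f n k δ ε σ A A' →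
          ∀ (v : Variant) (α : ℝ), √2 ≤ α → α ≤ 2 →
            DisconnectedIn x (nnGraph v α k x (r (level f σ A A'))) A A' ∧
            ConnectedIn x (nnGraph v α k x (r (level f σ A A'))) A ∧
            ConnectedIn x (nnGraph v α k x (r (level f σ A A'))) A' := by
  have := hf.isProbabilityMeasure
  have : IsProbabilityMeasure (sampleLaw f n) := by unfold sampleLaw; infer_instance
  refine ⟨levelRadius d n k ε, fun l hl => ?_, ?_⟩
  · rw [unitBallVolume_mul_levelRadius_pow_mul hd hε₀.le hl]
    exact ⟨le_mul_of_one_le_right (by positivity) (by linarith), le_rfl⟩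
  by_cases hres : ∃ σ A A', Resolvable X f n k δ ε σ A A'
  · obtain ⟨σ, A, A', h⟩ := hres
    have hkn := h.mul_le_sampleSize
    have hn₁ : 1 < n := by
      have hk' : (1 : ℝ) ≤ k := by exact_mod_cast hk
      exact_mod_cast (by nlinarith : (1 : ℝ) < n)
    obtain ⟨Λ, hΛ⟩ := WithTop.ne_top_iff_exists.1 (h.iSup_density_ne_top hd hn₁ hδ₀ hδ₁.le)
    have hΛ₀ := h.separated.level_pos.trans_le (h.level_le_of_forall_le (hf.le_of_iSup_eq hΛ.symm))
    obtain ⟨Ω, hΩ, hprob, htyp⟩ := exists_measurableSet_forall_of_measure_not_le hδ₀.le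
      (measure_not_isTypical_le hf hd hk hδ₀ hδ₁.le hε₀ hε₁ hkn hC (minRadius_pos hn hk hΛ₀)
        (minLevel_pos hd hn₁ hk hδ₀ hδ₁.le hΛ₀) (le_mul_minLevel_mul_minRadius_pow hd hn hk hΛ₀))
    exact ⟨Ω, hΩ, hprob, fun x hx σ A A' h v α hα₁ hα₂ =>
      h.disconnectedIn_and_connectedIn hf hd hn hk hε₀ hε₁.le hΛ.symm (htyp x hx) hα₁ hα₂⟩
  · refine ⟨Set.univ, .univ, ?_, fun x _ σ A A' h => (hres ⟨σ, A, A', h⟩).elim⟩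
    simpa using hδ₀.le


theorem theorem2 :
    ∃ C : ℝ, 0 < C ∧
      ∀ (d n k : ℕ) (δ ε α : ℝ) (v : ClusterTree.Variant)
        (X : Set (ClusterTree.E d)) (f : ClusterTree.E d → ℝ≥0),
        0 < d → 0 < n → 0 < k → 0 < δ → δ < 1 → 0 < ε → ε < 1 → √2 ≤ α → α ≤ 2 →
        ClusterTree.IsDensityOn f X →
        C * (d * Real.log n / ε ^ 2) * Real.log (2 / δ) ^ 2 ≤ k →
        ∃ r : ℝ≥0 → ℝ≥0,
          (∀ l : ℝ≥0, 0 < l →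
            (k / n : ℝ) ≤ ClusterTree.unitBallVolume d * (r l : ℝ) ^ d * l ∧
            ClusterTree.unitBallVolume d * (r l : ℝ) ^ d * l ≤ (k / n : ℝ) * (1 + ε / 2)) ∧
          ∃ Ω : Set (Fin n → ClusterTree.E d),
            MeasurableSet Ω ∧
            ENNReal.ofReal (1 - δ) ≤ ClusterTree.sampleLaw f n Ω ∧
            ∀ x ∈ Ω, ∀ (σ : ℝ) (A A' : Set (ClusterTree.E d)),
              0 < σ → ClusterTree.ConvexAtScale X σ →
              A ⊆ X → A' ⊆ X → IsPathConnected A → IsPathConnected A' →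
              ClusterTree.Separated X f σ ε A A' →
              (k : ℝ) / (ClusterTree.unitBallVolume d * (σ / 2) ^ d *
                  (ClusterTree.level f σ A A' : ℝ)) * (1 + ε / 2) ≤ n →
              (⨆ y ∈ X, (f y : ℝ≥0∞)) / (ClusterTree.level f σ A A' : ℝ≥0∞) *
                  ENNReal.ofReal (C * d * Real.log n * Real.log (2 / δ)) ≤ (k : ℝ≥0∞) →
              ClusterTree.DisconnectedIn x
                (ClusterTree.nnGraph v α k x (r (ClusterTree.level f σ A A'))) A A' ∧
              ClusterTree.ConnectedIn x
                (ClusterTree.nnGraph v α k x (r (ClusterTree.level f σ A A'))) A ∧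
              ClusterTree.ConnectedIn x
                (ClusterTree.nnGraph v α k x (r (ClusterTree.level f σ A A'))) A' := by
  refine ⟨1000, by norm_num, fun d n k δ ε α v X f hd hn hk hδ₀ hδ₁ hε₀ hε₁ hα₁ hα₂ hf hC => ?_⟩
  obtain ⟨r, hr, Ω, hΩ, hprob, h⟩ := theorem2_general d n k δ ε X f hd hn hk hδ₀ hδ₁ hε₀ hε₁ hf hC
  exact ⟨r, hr, Ω, hΩ, hprob, fun x hx σ A A' hσ hconv _ _ hA hA' hsep hσn hΛk =>
    h x hx σ A A' ⟨hσ, hconv, hA.isConnected, hA'.isConnected, hsep, hσn, hΛk⟩ v α hα₁ hα₂⟩
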